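/- Let $0<\alpha<1$ and let $\mathcal D$ be a probability distribution on $\mathbb Z$ with finite mean absolute value. At time $t=0$ the external price jumps to a value $p_{ext}^*\sim\mathcal D$ and stays there forever. In each slot $t=0,1,2,\dots$ a market maker, who knows $\alpha$ and $\mathcal D$ but not $p_{ext}^*$, quotes an ask $p_a^t$ and a bid $p_b^t$, and one trader arrives; the traders are i.i.d. and independent of $p_{ext}^*$. With probability $\alpha$ the trader is informed: he buys ($d_t=+1$) if $p_{ext}^*>p_a^t$, sells ($d_t=-1$) if $p_{ext}^*<p_b^t$, and otherwise does nothing ($d_t=0$). With probability $1-\alpha$ he is uninformed and buys or sells with probability $\tfrac12$ each. The market maker uses the Bayesian Glosten–Milgrom algorithm without further price jumps: $b^0=\mathcal D$, and for $t\ge 0$ the quotes $p_a^t,p_b^t$ are the solutions of $$p_a=\sum_{p\in\mathbb Z}p\,\frac{(\alpha\mathbf 1_{\{p>p_a\}}+\frac{1-\alpha}2)\,b^t(p)}{K_1},\qquad p_b=\sum_{p\in\mathbb Z}p\,\frac{(\alpha\mathbf 1_{\{p<p_b\}}+\frac{1-\alpha}2)\,b^t(p)}{K_2},$$ and $b^{t+1}(p)$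 equals $(\alpha\mathbf 1_{\{p>p_a^t\}}+\frac{1-\alpha}2)b^t(p)/K_1$ if $d_t=+1$, $(\alpha\mathbf 1_{\{p<p_b^t\}}+\frac{1-\alpha}2)b^t(p)/K_2$ if $d_t=-1$, and $\alpha\mathbf 1_{\{p_b^t\le p\le p_a^t\}}b^t(p)/K_3$ if $d_t=0$, where $K_1,K_2,K_3$ normalize the total mass to $1$. Then the spread tends to zero at an exponential rate: there is a constant $c>0$ depending only on $\alpha$ such that almost surely $p_a^t-p_b^t\to0$ and, for some finite random $C$, $|p_a^t-p_b^t|\le C e^{-ct}$ for all $t$. If $\mathcal D$ has finite support, the rate is exponential in expectation too: there are $c'>0$ and $C'$ with $E|p_a^t-p_b^t|\le C' e^{-c't}$ for all $t$. Moreover both quotes converge in probability to the external price: for every $\varepsilon>0$, $$\lim_{t\to\infty}\Pr[\,|p_a^t-p_{ext}^*|\ge\varepsilon\,]=0,\qquad \lim_{t\to\infty}\Pr[\,|p_b^t-p_{ext}^*|\ge\varepsilon\,]=0 .$$ -/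

import Mathlib

open Filter Topology MeasureTheory ProbabilityTheory

universe u

noncomputable section

namespace GlostenMilgrom

/-- What the market maker observes in a time slot: `d = +1`, `d = -1` or `d = 0`. -/
inductive Trade
  | buy
  | sell
  | none

/-- The trader who arrives in a time slot: informed, or uninformed with the outcome of the fair coin
that decides between buying and selling. -/
inductive Trader
  | informed
  | noiseBuy
  | noiseSell

instance : MeasurableSpace Trader := ⊤

/-- What a trader does when the external price is `p` and the quotes are `ask`, `bid`. -/
def action (p ask bid : ℝ) : Trader → Trade
  | .informed => if ask < p then .buy else if p < bid then .sell else .none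
  | .noiseBuy => .buy
  | .noiseSell => .sell

/-- Division of nonnegative weights on `ℤ` by their total mass. -/
def normalize (w : ℤ → ℝ) : ℤ → ℝ := fun p => w p / ∑' q, w q

/-- Posterior belief after a buy at the ask price `x`, starting from the belief `b`. -/
def buyPosterior (α : ℝ) (b : ℤ → ℝ) (x : ℝ) : ℤ → ℝ :=
  normalize fun p => (α * (if x < (p : ℝ) then 1 else 0) + (1 - α) / 2) * b p

/-- Posterior belief after a sell at the bid price `x`, starting from the belief `b`. -/
def sellPosterior (α : ℝ) (b : ℤ → ℝ) (x : ℝ) : ℤ → ℝ :=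
  normalize fun p => (α * (if (p : ℝ) < x then 1 else 0) + (1 - α) / 2) * b p

/-- Posterior belief after a slot without trade: the trader was informed and `bid ≤ p ≤ ask`. -/
def noTradePosterior (α : ℝ) (b : ℤ → ℝ) (ask bid : ℝ) : ℤ → ℝ :=
  normalize fun p => α * (if bid ≤ (p : ℝ) ∧ (p : ℝ) ≤ ask then 1 else 0) * b p

/-- The ask price: a solution `x` of `x = E[p | buy at ask price x]`. For `0 < α < 1` and a belief with
finite mean the equation has exactly one solution. -/
def askPrice (α : ℝ) (b : ℤ → ℝ) : ℝ :=
  Classical.epsilon fun x : ℝ => x = ∑' p : ℤ, (p : ℝ) * buyPosterior α b x p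

/-- The bid price: a solution `x` of `x = E[p | sell at bid price x]`. For `0 < α < 1` and a belief with
finite mean the equation has exactly one solution. -/
def bidPrice (α : ℝ) (b : ℤ → ℝ) : ℝ :=
  Classical.epsilon fun x : ℝ => x = ∑' p : ℤ, (p : ℝ) * sellPosterior α b x p

/-- Belief update that accounts for a `±1` jump of the external price with probability `σ`. -/
def jumpUpdate (σ : ℝ) (b : ℤ → ℝ) : ℤ → ℝ :=
  fun p => (1 - σ) * b p + σ / 2 * b (p - 1) + σ / 2 * b (p + 1)

/-- One round of the Bayesian algorithm: from the belief `b` and the observed trade to the next belief. -/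
def nextBelief (α σ : ℝ) (b : ℤ → ℝ) : Trade → ℤ → ℝ
  | .buy => jumpUpdate σ (buyPosterior α b (askPrice α b))
  | .sell => jumpUpdate σ (sellPosterior α b (bidPrice α b))
  | .none => jumpUpdate σ (noTradePosterior α b (askPrice α b) (bidPrice α b))

/-- The beliefs `b^t` of the Bayesian algorithm with prior `b₀`, when `price t` is the external price and
`tr t` the trader in slot `t`. The algorithm sees these only through the trades. -/
def belief (α σ : ℝ) (b₀ : ℤ → ℝ) (price : ℕ → ℤ) (tr : ℕ → Trader) : ℕ → ℤ → ℝ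
  | 0 => b₀
  | t + 1 =>
    let b := belief α σ b₀ price tr t
    nextBelief α σ b (action (price t) (askPrice α b) (bidPrice α b) (tr t))

variable {Ω : Type u}

/-- The ask price quoted in slot `t` when the external price has the constant value `pext` after the
single jump, its law `D` is the prior, and there are no further jumps (`σ = 0`). -/
def ask (α : ℝ) (D : PMF ℤ) (pext : Ω → ℤ) (trader : ℕ → Ω → Trader) (t : ℕ) (ω : Ω) : ℝ :=
  askPrice α (belief α 0 (fun p => (D p).toReal) (fun _ => pext ω) (fun s => trader s ω) t)

/-- The bid price quoted in slot `t`, in the same situation as for `ask`. -/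
def bid (α : ℝ) (D : PMF ℤ) (pext : Ω → ℤ) (trader : ℕ → Ω → Trader) (t : ℕ) (ω : Ω) : ℝ :=
  bidPrice α (belief α 0 (fun p => (D p).toReal) (fun _ => pext ω) (fun s => trader s ω) t)

/-- The single-jump market: `pext` has law `D`; the traders are i.i.d. and independent of `pext`, and
each is informed with probability `α` and otherwise buys or sells with equal probability. -/
structure IsSingleJumpMarket [MeasurableSpace Ω] (μ : Measure Ω) (α : ℝ) (D : PMF ℤ)
    (pext : Ω → ℤ) (trader : ℕ → Ω → Trader) : Prop where
  measurable_pext : Measurable pext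
  map_pext : μ.map pext = D.toMeasure
  measurable_trader : ∀ t, Measurable (trader t)
  prob_informed : ∀ t, μ {ω | trader t ω = .informed} = ENNReal.ofReal α
  prob_noiseBuy : ∀ t, μ {ω | trader t ω = .noiseBuy} = ENNReal.ofReal ((1 - α) / 2)
  prob_noiseSell : ∀ t, μ {ω | trader t ω = .noiseSell} = ENNReal.ofReal ((1 - α) / 2)
  indep_traders : iIndepFun trader μ
  indep_pext : IndepFun pext (fun ω t => trader t ω) μ

end GlostenMilgrom

end

open GlostenMilgrom

/-! For a belief `b` let U(x) and D(x) be the expected excess of the price over x and its expected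
shortfall below x. After clearing the normalization, the ask is the point where (1+α)/2·U =
(1-α)/2·D, and the bid is its mirror image. So comparing a quote with x amounts to an inequality
between U(x) and D(x), and both quotes lie within a constant times U(x) + D(x) of any x.

Convergence. By Bayes' rule (`lintegral_eq_tsum_belief`) the belief is the conditional law of the
price, and `evidence` is the predictive law of the next trade. Under that law √(b(p)b(q)) is a
supermartingale for every pair of prices. Whenever the quotes make informed traders act differently
at p and q, it loses a fixed fraction in conditional expectation, because the two trade laws have
Hellinger affinity at most `affinity α` < 1. Hence the overlaps of separated pairs are summable, and
vanish almost surely (`ae_tendsto_sepOverlap`). By Lévy's upward theorem the beliefs also converge,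
together with U and D at integers, to the conditional law given all trades. If that law had two
atoms, it would have atoms on both sides of its own ask, and late beliefs would separate these while
their overlap stays positive (`IsBelief.eq_of_tendsto`). So the limit is a point mass; it charges
the true price, and the quotes converge to it.

Rate. Once both quotes are within one tick of the true price P, every price above P is above the ask
and every price below P is below the bid. Up to a common normalization, a trade then multiplies
U(P), D(P) and b(P) by explicit factors, and given P the square root of max(U(P), D(P))/b(P)
contracts in mean by √(1-α²) (`sum_like_mul_sqrt_oddsRisk_le`). This yields the almost sure rate,
which depends only on α.

Finite support. Here the sum of √(b(p)b(q)) over distinct pairs contracts uniformly from every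
belief (`exists_totalOverlap_contraction`), because the quotes always separate the mode from prices
carrying a fixed share of the deviation. -/

noncomputable section

namespace GlostenMilgrom

/-! ### Beliefs, one-sided deviations and the quotes -/

/-- A probability vector on `ℤ` with finite first moment. -/
structure IsBelief (b : ℤ → ℝ) : Prop where
  nonneg : ∀ p, 0 ≤ b p
  summable_abs : Summable fun p : ℤ => |(p : ℝ)| * b p
  hasSum : HasSum b 1

/-- The expected excess of the price over `x` under the belief `b`. -/
def upside (b : ℤ → ℝ) (x : ℝ) : ℝ := ∑' p : ℤ, max ((p : ℝ) - x) 0 * b p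

/-- The expected shortfall of the price below `x` under the belief `b`. -/
def downside (b : ℤ → ℝ) (x : ℝ) : ℝ := ∑' p : ℤ, max (x - (p : ℝ)) 0 * b p

/-- The mean of a belief. -/
def mean (b : ℤ → ℝ) : ℝ := ∑' p : ℤ, (p : ℝ) * b p

namespace IsBelief

variable {b : ℤ → ℝ}

lemma summable_mul (hb : IsBelief b) {f : ℤ → ℝ} (A B : ℝ)
    (hf : ∀ p : ℤ, |f p| ≤ A + B * |(p : ℝ)|) : Summable fun p => f p * b p := by
  refine Summable.of_norm_bounded
    (g := fun p : ℤ => A * b p + B * (|(p : ℝ)| * b p))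
    ((hb.hasSum.summable.mul_left A).add (hb.summable_abs.mul_left B)) fun p => ?_
  rw [Real.norm_eq_abs, abs_mul, abs_of_nonneg (hb.nonneg p)]
  calc |f p| * b p ≤ (A + B * |(p : ℝ)|) * b p :=
        mul_le_mul_of_nonneg_right (hf p) (hb.nonneg p)
    _ = _ := by ring

lemma summable_id (hb : IsBelief b) : Summable fun p : ℤ => (p : ℝ) * b p :=
  hb.summable_mul 0 1 fun p => by simp

lemma abs_pos_part_le (p : ℤ) (x : ℝ) : |max ((p : ℝ) - x) 0| ≤ |x| + 1 * |(p : ℝ)| := by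
  rw [abs_of_nonneg (le_max_right _ _)]
  refine max_le ?_ (by positivity)
  linarith [le_abs_self (p : ℝ), neg_abs_le x]

lemma abs_neg_part_le (p : ℤ) (x : ℝ) : |max (x - (p : ℝ)) 0| ≤ |x| + 1 * |(p : ℝ)| := by
  rw [abs_of_nonneg (le_max_right _ _)]
  refine max_le ?_ (by positivity)
  linarith [neg_abs_le (p : ℝ), le_abs_self x]

lemma summable_upside (hb : IsBelief b) (x : ℝ) :
    Summable fun p : ℤ => max ((p : ℝ) - x) 0 * b p :=
  hb.summable_mul _ _ fun p => abs_pos_part_le p x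

lemma summable_downside (hb : IsBelief b) (x : ℝ) :
    Summable fun p : ℤ => max (x - (p : ℝ)) 0 * b p :=
  hb.summable_mul _ _ fun p => abs_neg_part_le p x

lemma upside_nonneg (hb : IsBelief b) (x : ℝ) : 0 ≤ upside b x :=
  tsum_nonneg fun p => mul_nonneg (le_max_right _ _) (hb.nonneg p)

lemma downside_nonneg (hb : IsBelief b) (x : ℝ) : 0 ≤ downside b x :=
  tsum_nonneg fun p => mul_nonneg (le_max_right _ _) (hb.nonneg p)

lemma upside_sub_downside (hb : IsBelief b) (x : ℝ) :
    upside b x - downside b x = mean b - x := by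
  have h1 : HasSum (fun p : ℤ => (p : ℝ) * b p - x * b p) (mean b - x * 1) :=
    hb.summable_id.hasSum.sub (hb.hasSum.mul_left x)
  have h2 := (hb.summable_upside x).hasSum.sub (hb.summable_downside x).hasSum
  rw [mul_one] at h1
  refine h2.unique (h1.congr_fun ?_) |>.trans rfl
  intro p
  rcases le_total (p : ℝ) x with h | h
  · rw [max_eq_right (by linarith), max_eq_left (by linarith)]; ring
  · rw [max_eq_left (by linarith), max_eq_right (by linarith)]; ring

lemma upside_anti (hb : IsBelief b) {x y : ℝ} (h : x ≤ y) : upside b y ≤ upside b x :=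
  (hb.summable_upside y).tsum_le_tsum
    (fun p => mul_le_mul_of_nonneg_right (max_le_max (by linarith) le_rfl) (hb.nonneg p))
    (hb.summable_upside x)

lemma downside_mono (hb : IsBelief b) {x y : ℝ} (h : x ≤ y) : downside b x ≤ downside b y :=
  (hb.summable_downside x).tsum_le_tsum
    (fun p => mul_le_mul_of_nonneg_right (max_le_max (by linarith) le_rfl) (hb.nonneg p))
    (hb.summable_downside y)

/-- `upside b` decreases while x + `upside b x` = `mean b + downside b x` increases, so `upside b`
is 1-Lipschitz. -/
lemma continuous_upside (hb : IsBelief b) : Continuous (upside b) := by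
  have key : ∀ x y, x ≤ y → upside b x ≤ upside b y + (y - x) := by
    intro x y h
    have e1 := hb.upside_sub_downside x
    have e2 := hb.upside_sub_downside y
    linarith [hb.downside_mono h]
  refine LipschitzWith.continuous (K := 1) (LipschitzWith.of_dist_le_mul fun x y => ?_)
  rw [Real.dist_eq, Real.dist_eq, NNReal.coe_one, one_mul]
  rcases le_total x y with h | h
  · rw [abs_of_nonneg (by linarith [hb.upside_anti h]), abs_of_nonpos (by linarith)]
    linarith [key x y h]
  · rw [abs_of_nonpos (by linarith [hb.upside_anti h]), abs_of_nonneg (by linarith)]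
    linarith [key y x h]

/-- The reflection `p ↦ -p` exchanges the two sides of the market. -/
lemma neg (hb : IsBelief b) : IsBelief fun p => b (-p) where
  nonneg p := hb.nonneg _
  summable_abs := by
    have := (Equiv.neg ℤ).summable_iff.mpr hb.summable_abs
    simpa [Function.comp_def] using this
  hasSum := (Equiv.neg ℤ).hasSum_iff.mpr hb.hasSum

lemma upside_neg (b : ℤ → ℝ) (x : ℝ) : upside (fun p => b (-p)) x = downside b (-x) := by
  unfold upside downside
  rw [← (Equiv.neg ℤ).tsum_eq]
  refine tsum_congr fun p => ?_
  simp only [Equiv.neg_apply, neg_neg, Int.cast_neg]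
  ring_nf

lemma mean_neg (b : ℤ → ℝ) : mean (fun p => b (-p)) = -mean b := by
  unfold mean
  rw [← (Equiv.neg ℤ).tsum_eq, ← tsum_neg]
  refine tsum_congr fun p => ?_
  simp

lemma exists_ask_equation {α : ℝ} (hα0 : 0 < α) (hα1 : α < 1) (hb : IsBelief b) :
    ∃ x, α * upside b x = (1 - α) / 2 * (x - mean b) := by
  set g : ℝ → ℝ := fun x => α * upside b x - (1 - α) / 2 * (x - mean b) with hg
  have hβ : 0 < (1 - α) / 2 := by linarith
  -- The point where the linear term alone reaches α·U(mean); since U decreases, g ≤ 0 there, while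
  -- g ≥ 0 at the mean.
  set y := mean b + α * upside b (mean b) / ((1 - α) / 2) with hy
  have hU := hb.upside_nonneg (mean b)
  have hle : mean b ≤ y := by
    have : 0 ≤ α * upside b (mean b) / ((1 - α) / 2) := by positivity
    linarith
  have hc : ContinuousOn g (Set.Icc (mean b) y) := by
    have := hb.continuous_upside
    fun_prop
  have h0 : (0 : ℝ) ∈ Set.Icc (g y) (g (mean b)) := by
    constructor
    · have h2 := hb.upside_anti hle
      have h3 : (1 - α) / 2 * (y - mean b) = α * upside b (mean b) := by
        rw [hy, add_sub_cancel_left, mul_div_cancel₀ _ hβ.ne']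
      simp only [hg]
      nlinarith
    · simp only [hg, sub_self, mul_zero, sub_zero]
      positivity
  obtain ⟨x, -, hx⟩ := intermediate_value_Icc' hle hc h0
  exact ⟨x, by simp only [hg] at hx; linarith⟩

/-- The normalizing mass is at least (1-α)/2, so it can be cleared: the equation says that the
weighted sum of p - x vanishes, and its informed part is α·U(x). -/
lemma ask_equation_iff {α : ℝ} (hα0 : 0 < α) (hα1 : α < 1) (hb : IsBelief b) (x : ℝ) :
    x = ∑' p : ℤ, (p : ℝ) * buyPosterior α b x p ↔
      α * upside b x = (1 - α) / 2 * (x - mean b) := by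
  have hβ : 0 < (1 - α) / 2 := by linarith
  set w : ℤ → ℝ := fun p => (α * (if x < (p : ℝ) then 1 else 0) + (1 - α) / 2) * b p with hw
  have hw1 : ∀ p : ℤ, |α * (if x < (p : ℝ) then 1 else 0) + (1 - α) / 2| ≤ 1 := by
    intro p; split_ifs <;> rw [abs_le] <;> constructor <;> linarith
  have hsw : Summable w := hb.summable_mul 1 0 fun p => by simpa using hw1 p
  have hspw : Summable fun p : ℤ => (p : ℝ) * w p := by
    have : Summable fun p : ℤ =>
        ((p : ℝ) * (α * (if x < (p : ℝ) then 1 else 0) + (1 - α) / 2)) * b p :=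
      hb.summable_mul 0 1 fun p => by
        rw [abs_mul]; nlinarith [hw1 p, abs_nonneg (p : ℝ)]
    refine this.congr fun p => ?_
    simp only [hw]; ring
  have hK : 0 < ∑' p, w p := by
    have : (1 - α) / 2 * 1 ≤ ∑' p, w p :=
      hasSum_le (fun p => by
        simp only [hw]
        refine mul_le_mul_of_nonneg_right ?_ (hb.nonneg p)
        split_ifs <;> linarith) (hb.hasSum.mul_left _) hsw.hasSum
    linarith
  have e1 : ∑' p : ℤ, (p : ℝ) * buyPosterior α b x p = (∑' p : ℤ, (p : ℝ) * w p) / ∑' p, w p := by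
    rw [← tsum_div_const]
    refine tsum_congr fun p => ?_
    simp only [buyPosterior, normalize, hw]
    ring
  have e2 : ∑' p : ℤ, (p : ℝ) * w p - x * ∑' p, w p
      = α * upside b x + (1 - α) / 2 * (mean b - x) := by
    have h1 := hspw.hasSum.sub (hsw.hasSum.mul_left x)
    have h2 := ((hb.summable_upside x).hasSum.mul_left α).add
      ((hb.summable_id.hasSum.sub (hb.hasSum.mul_left x)).mul_left ((1 - α) / 2))
    rw [mul_one] at h2
    refine h1.unique (h2.congr_fun ?_) |>.trans rfl
    intro p
    simp only [hw]
    split_ifs with h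
    · rw [max_eq_left (by linarith)]; ring
    · rw [max_eq_right (by linarith)]; ring
  rw [e1, eq_div_iff hK.ne']
  constructor <;> intro h <;> linarith

lemma askPrice_spec {α : ℝ} (hα0 : 0 < α) (hα1 : α < 1) (hb : IsBelief b) :
    α * upside b (askPrice α b) = (1 - α) / 2 * (askPrice α b - mean b) := by
  rw [← hb.ask_equation_iff hα0 hα1]
  obtain ⟨x, hx⟩ := hb.exists_ask_equation hα0 hα1
  rw [← hb.ask_equation_iff hα0 hα1] at hx
  exact Classical.epsilon_spec (p := fun x : ℝ => x = ∑' p : ℤ, (p : ℝ) * buyPosterior α b x p)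
    ⟨x, hx⟩

lemma sellPosterior_eq (α : ℝ) (b : ℤ → ℝ) (x : ℝ) (p : ℤ) :
    sellPosterior α b x p = buyPosterior α (fun q => b (-q)) (-x) (-p) := by
  unfold sellPosterior buyPosterior normalize
  simp only [neg_neg, Int.cast_neg, neg_lt_neg_iff]
  congr 1
  rw [← (Equiv.neg ℤ).tsum_eq]
  refine tsum_congr fun p => ?_
  simp only [Equiv.neg_apply, Int.cast_neg]
  simp [neg_lt]

/-- The reflection is applied to the equations and not to the prices: the two `Classical.epsilon`
choices are not known to correspond before solvability is established. -/
lemma bid_equation_iff_neg (α : ℝ) (b : ℤ → ℝ) (x : ℝ) :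
    x = ∑' p : ℤ, (p : ℝ) * sellPosterior α b x p ↔
      -x = ∑' p : ℤ, (p : ℝ) * buyPosterior α (fun q => b (-q)) (-x) p := by
  have : ∑' p : ℤ, (p : ℝ) * sellPosterior α b x p =
      -∑' p : ℤ, (p : ℝ) * buyPosterior α (fun q => b (-q)) (-x) p := by
    rw [← tsum_neg, ← (Equiv.neg ℤ).tsum_eq]
    refine tsum_congr fun p => ?_
    simp only [sellPosterior_eq, Equiv.neg_apply, neg_neg, Int.cast_neg]
    ring
  rw [this]
  constructor <;> intro h <;> linarith

lemma bidPrice_spec {α : ℝ} (hα0 : 0 < α) (hα1 : α < 1) (hb : IsBelief b) :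
    α * downside b (bidPrice α b) = (1 - α) / 2 * (mean b - bidPrice α b) := by
  obtain ⟨y, hy⟩ := hb.neg.exists_ask_equation hα0 hα1
  rw [← hb.neg.ask_equation_iff hα0 hα1] at hy
  have hex : ∃ x : ℝ, x = ∑' p : ℤ, (p : ℝ) * sellPosterior α b x p :=
    ⟨-y, by rw [bid_equation_iff_neg, neg_neg]; exact hy⟩
  have h := Classical.epsilon_spec hex
  change bidPrice α b = ∑' p : ℤ, (p : ℝ) * sellPosterior α b (bidPrice α b) p at h
  rw [bid_equation_iff_neg, hb.neg.ask_equation_iff hα0 hα1, upside_neg, neg_neg, mean_neg] at h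
  linarith

section Quotes

variable {α : ℝ} (hα0 : 0 < α) (hα1 : α < 1)
include hα0 hα1

lemma askPrice_balance (hb : IsBelief b) :
    (1 + α) / 2 * upside b (askPrice α b) = (1 - α) / 2 * downside b (askPrice α b) := by
  have h1 := hb.askPrice_spec hα0 hα1
  have h2 := hb.upside_sub_downside (askPrice α b)
  linear_combination h1 + (1 - α) / 2 * h2

lemma bidPrice_balance (hb : IsBelief b) :
    (1 + α) / 2 * downside b (bidPrice α b) = (1 - α) / 2 * upside b (bidPrice α b) := by
  have h1 := hb.bidPrice_spec hα0 hα1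
  have h2 := hb.upside_sub_downside (bidPrice α b)
  linear_combination h1 - (1 - α) / 2 * h2

/-- The function (1+α)/2·U - (1-α)/2·D = α·U(x) - (1-α)/2·(x - mean) is strictly decreasing and
vanishes at the ask. In this form comparisons with the ask survive limits of beliefs without any
convergence of the ask itself. -/
lemma askPrice_lt_iff (hb : IsBelief b) (x : ℝ) :
    askPrice α b < x ↔ (1 + α) / 2 * upside b x < (1 - α) / 2 * downside b x := by
  have h1 := hb.askPrice_spec hα0 hα1
  have h2 := hb.upside_sub_downside x
  constructor
  · intro h
    have := hb.upside_anti h.le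
    nlinarith
  · intro h
    by_contra! hx
    have := hb.upside_anti hx
    nlinarith

lemma lt_bidPrice_iff (hb : IsBelief b) (x : ℝ) :
    x < bidPrice α b ↔ (1 + α) / 2 * downside b x < (1 - α) / 2 * upside b x := by
  have h1 := hb.bidPrice_spec hα0 hα1
  have h2 := hb.upside_sub_downside x
  constructor
  · intro h
    have := hb.downside_mono h.le
    nlinarith
  · intro h
    by_contra! hx
    have := hb.downside_mono hx
    nlinarith

lemma lt_askPrice_iff (hb : IsBelief b) (x : ℝ) :
    x < askPrice α b ↔ (1 - α) / 2 * downside b x < (1 + α) / 2 * upside b x := by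
  have h1 := hb.askPrice_spec hα0 hα1
  have h2 := hb.upside_sub_downside x
  constructor
  · intro h
    have := hb.upside_anti h.le
    nlinarith
  · intro h
    by_contra! hx
    have := hb.upside_anti hx
    nlinarith

lemma mean_le_askPrice (hb : IsBelief b) : mean b ≤ askPrice α b := by
  have h1 := hb.askPrice_spec hα0 hα1
  have := hb.upside_nonneg (askPrice α b)
  have : 0 ≤ α * upside b (askPrice α b) := by positivity
  nlinarith

lemma bidPrice_le_mean (hb : IsBelief b) : bidPrice α b ≤ mean b := by
  have h1 := hb.bidPrice_spec hα0 hα1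
  have := hb.downside_nonneg (bidPrice α b)
  have : 0 ≤ α * downside b (bidPrice α b) := by positivity
  nlinarith

lemma bidPrice_le_askPrice (hb : IsBelief b) : bidPrice α b ≤ askPrice α b :=
  (hb.bidPrice_le_mean hα0 hα1).trans (hb.mean_le_askPrice hα0 hα1)

lemma abs_askPrice_sub_le (hb : IsBelief b) (x : ℝ) :
    |askPrice α b - x| ≤ (1 + α) / (1 - α) * (upside b x + downside b x) := by
  have h1 := hb.askPrice_spec hα0 hα1
  have h2 := hb.upside_sub_downside x
  have hU := hb.upside_nonneg x
  have hD := hb.downside_nonneg x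
  have hUa := hb.upside_nonneg (askPrice α b)
  have hβ : 0 < 1 - α := by linarith
  have e : (1 + α) / (1 - α) * (upside b x + downside b x)
      = ((1 + α) * (upside b x + downside b x)) / (1 - α) := by ring
  rw [e, le_div_iff₀ hβ]
  rcases le_total x (askPrice α b) with h | h
  · rw [abs_of_nonneg (by linarith)]
    have := hb.upside_anti h
    nlinarith
  · rw [abs_of_nonpos (by linarith)]
    nlinarith [mul_nonneg hα0.le hUa]

lemma abs_bidPrice_sub_le (hb : IsBelief b) (x : ℝ) :
    |bidPrice α b - x| ≤ (1 + α) / (1 - α) * (upside b x + downside b x) := by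
  have h1 := hb.bidPrice_spec hα0 hα1
  have h2 := hb.upside_sub_downside x
  have hU := hb.upside_nonneg x
  have hD := hb.downside_nonneg x
  have hUa := hb.downside_nonneg (bidPrice α b)
  have hβ : 0 < 1 - α := by linarith
  have e : (1 + α) / (1 - α) * (upside b x + downside b x)
      = ((1 + α) * (upside b x + downside b x)) / (1 - α) := by ring
  rw [e, le_div_iff₀ hβ]
  rcases le_total x (bidPrice α b) with h | h
  · rw [abs_of_nonneg (by linarith)]
    nlinarith [mul_nonneg hα0.le hUa]
  · rw [abs_of_nonpos (by linarith)]
    have := hb.downside_mono h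
    nlinarith

end Quotes

end IsBelief

/-! ### Trades as signals: likelihoods and the posterior -/

open scoped ENNReal

instance : DecidableEq Trade := Classical.decEq _

instance : Fintype Trade where
  elems := {.buy, .sell, .none}
  complete d := by cases d <;> simp

lemma sum_trade {M : Type*} [AddCommMonoid M] (f : Trade → M) :
    ∑ d, f d = f .buy + (f .sell + f .none) := by
  change ∑ d ∈ ({.buy, .sell, .none} : Finset Trade), f d = _
  rw [Finset.sum_insert (by simp), Finset.sum_insert (by simp), Finset.sum_singleton]

instance : DecidableEq Trader := Classical.decEq _

instance : Fintype Trader where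
  elems := {.informed, .noiseBuy, .noiseSell}
  complete d := by cases d <;> simp

lemma sum_trader {M : Type*} [AddCommMonoid M] (f : Trader → M) :
    ∑ d, f d = f .informed + (f .noiseBuy + f .noiseSell) := by
  change ∑ d ∈ ({.informed, .noiseBuy, .noiseSell} : Finset Trader), f d = _
  rw [Finset.sum_insert (by simp), Finset.sum_insert (by simp), Finset.sum_singleton]

instance : DiscreteMeasurableSpace Trader := ⟨fun _ => trivial⟩

instance : MeasurableSpace (List Trade) := ⊤

instance : DiscreteMeasurableSpace (List Trade) := ⟨fun _ => trivial⟩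

/-- The trade of an informed trader who knows that the price is `p`, at the quotes for `b`. -/
def typ (α : ℝ) (b : ℤ → ℝ) (p : ℤ) : Trade :=
  action p (askPrice α b) (bidPrice α b) .informed

/-- The probability of the trade `d` when the price is `p`, at the quotes for the belief `b`. -/
def like (α : ℝ) (b : ℤ → ℝ) (d : Trade) (p : ℤ) : ℝ :=
  (if typ α b p = d then α else 0) + if d = .none then 0 else (1 - α) / 2

/-- The probability of the trade `d` under the belief `b`. -/
def evidence (α : ℝ) (b : ℤ → ℝ) (d : Trade) : ℝ := ∑' p, like α b d p * b p

section Like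

variable {α : ℝ} (hα0 : 0 < α) (hα1 : α < 1)
include hα0 hα1

lemma like_nonneg (b : ℤ → ℝ) (d : Trade) (p : ℤ) : 0 ≤ like α b d p := by
  unfold like; split_ifs <;> linarith

lemma like_le_one (b : ℤ → ℝ) (d : Trade) (p : ℤ) : like α b d p ≤ 1 := by
  unfold like; split_ifs <;> linarith

lemma abs_like_le_one (b : ℤ → ℝ) (d : Trade) (p : ℤ) : |like α b d p| ≤ 1 := by
  rw [abs_of_nonneg (like_nonneg hα0 hα1 b d p)]
  exact like_le_one hα0 hα1 b d p

/-- Beliefs reached with probability zero are represented by `0`. -/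
lemma nextBelief_eq {b : ℤ → ℝ} (hb : IsBelief b ∨ b = 0) (d : Trade) (p : ℤ) :
    nextBelief α 0 b d p = like α b d p * b p / evidence α b d := by
  have hj : ∀ c : ℤ → ℝ, jumpUpdate 0 c p = c p := fun c => by simp [jumpUpdate]
  rcases hb with hb | rfl
  · have hle := hb.bidPrice_le_askPrice hα0 hα1
    cases d <;> simp only [nextBelief, hj, buyPosterior, sellPosterior, noTradePosterior,
      normalize, evidence]
    · have : ∀ q : ℤ, α * (if askPrice α b < q then 1 else 0) + (1 - α) / 2
          = like α b .buy q := fun q => by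
        simp only [like, typ, action]; split_ifs <;> simp_all
      simp only [this]
    · have : ∀ q : ℤ, α * (if (q : ℝ) < bidPrice α b then 1 else 0) + (1 - α) / 2
          = like α b .sell q := fun q => by
        simp only [like, typ, action]
        split_ifs <;> simp_all
        linarith
      simp only [this]
    · have : ∀ q : ℤ, α * (if bidPrice α b ≤ q ∧ (q : ℝ) ≤ askPrice α b then 1 else 0)
          = like α b .none q := fun q => by
        simp only [like, typ, action]
        split_ifs with h1 h2 h3 <;> simp_all <;> linarith [h1.1, h1.2]
      simp only [this]
  · cases d <;> simp [nextBelief, hj, buyPosterior, sellPosterior, noTradePosterior, normalize]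

lemma summable_like_mul {b : ℤ → ℝ} (hb : IsBelief b) (d : Trade) :
    Summable fun p => like α b d p * b p :=
  hb.summable_mul 1 0 fun p => by simpa using abs_like_le_one hα0 hα1 b d p

lemma evidence_nonneg {b : ℤ → ℝ} (hb : IsBelief b ∨ b = 0) (d : Trade) : 0 ≤ evidence α b d := by
  rcases hb with hb | rfl
  · exact tsum_nonneg fun p => mul_nonneg (like_nonneg hα0 hα1 b d p) (hb.nonneg p)
  · simp [evidence]

/-- Without the denominator Bayes' rule also covers trades of probability zero: there a nonnegative
series has sum zero, so every term vanishes. -/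
lemma evidence_mul_nextBelief {b : ℤ → ℝ} (hb : IsBelief b ∨ b = 0) (d : Trade) (p : ℤ) :
    evidence α b d * nextBelief α 0 b d p = like α b d p * b p := by
  rw [nextBelief_eq hα0 hα1 hb]
  rcases eq_or_ne (evidence α b d) 0 with h | h
  · rw [h, zero_mul]
    rcases hb with hb | rfl
    · have hs : HasSum (fun q => like α b d q * b q) (evidence α b d) :=
        (summable_like_mul hα0 hα1 hb d).hasSum
      rw [h] at hs
      have h0 := (hasSum_zero_iff_of_nonneg fun q =>
        mul_nonneg (like_nonneg hα0 hα1 b d q) (hb.nonneg q)).mp hs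
      exact (congrFun h0 p).symm
    · simp
  · field_simp

lemma isBelief_or_zero_nextBelief {b : ℤ → ℝ} (hb : IsBelief b ∨ b = 0) (d : Trade) :
    IsBelief (nextBelief α 0 b d) ∨ nextBelief α 0 b d = 0 := by
  have he : nextBelief α 0 b d = fun p => like α b d p * b p / evidence α b d :=
    funext fun p => nextBelief_eq hα0 hα1 hb d p
  rcases eq_or_ne (evidence α b d) 0 with h | h
  · right; rw [he]; funext p; simp [h]
  · rcases hb with hb | rfl
    · left
      rw [he]
      refine ⟨fun p => div_nonneg (mul_nonneg (like_nonneg hα0 hα1 b d p) (hb.nonneg p))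
        (evidence_nonneg hα0 hα1 (Or.inl hb) d), ?_, ?_⟩
      · have : Summable fun p : ℤ => (|(p : ℝ)| * like α b d p) * b p :=
          hb.summable_mul 0 1 fun p => by
            rw [abs_mul, abs_abs]
            nlinarith [abs_like_le_one hα0 hα1 b d p, abs_nonneg (p : ℝ)]
        refine (this.div_const (evidence α b d)).congr fun p => ?_
        ring
      · have := (summable_like_mul hα0 hα1 hb d).hasSum.div_const (evidence α b d)
        rwa [show ∑' p, like α b d p * b p = evidence α b d from rfl, div_self h] at this
    · simp [evidence] at h

end Like

/-! ### Beliefs as functions of the trade history -/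

/-- The belief of the market maker after a list of trades (the latest one first). -/
def beliefAt (α : ℝ) (D : PMF ℤ) : List Trade → ℤ → ℝ
  | [] => fun p => (D p).toReal
  | d :: h => nextBelief α 0 (beliefAt α D h) d

/-- The list of the first `t` trades (the latest one first) when the price is `P`. -/
def history (α : ℝ) (D : PMF ℤ) (P : ℤ) (tr : ℕ → Trader) : ℕ → List Trade
  | 0 => []
  | t + 1 =>
    action P (askPrice α (beliefAt α D (history α D P tr t)))
      (bidPrice α (beliefAt α D (history α D P tr t))) (tr t) :: history α D P tr t

lemma length_history (α : ℝ) (D : PMF ℤ) (P : ℤ) (tr : ℕ → Trader) (t : ℕ) :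
    (history α D P tr t).length = t := by
  induction t with
  | zero => rfl
  | succ t ih => simp [history, ih]

lemma history_congr (α : ℝ) (D : PMF ℤ) (P : ℤ) {tr tr' : ℕ → Trader} (t : ℕ)
    (h : ∀ s < t, tr s = tr' s) : history α D P tr t = history α D P tr' t := by
  induction t with
  | zero => rfl
  | succ t ih =>
    have := ih fun s hs => h s (by omega)
    simp only [history, this, h t (by omega)]

lemma belief_eq_beliefAt (α : ℝ) (D : PMF ℤ) (P : ℤ) (tr : ℕ → Trader) (t : ℕ) :
    belief α 0 (fun p => (D p).toReal) (fun _ => P) tr t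
      = beliefAt α D (history α D P tr t) := by
  induction t with
  | zero => rfl
  | succ t ih => simp only [belief, history, beliefAt, ih]

lemma isBelief_prior {D : PMF ℤ} (hD : Summable fun p : ℤ => |(p : ℝ)| * (D p).toReal) :
    IsBelief fun p => (D p).toReal where
  nonneg _ := ENNReal.toReal_nonneg
  summable_abs := hD
  hasSum := by
    have h := ENNReal.hasSum_toReal (f := fun p => D p) (by rw [D.tsum_coe]; simp)
    rwa [← ENNReal.tsum_toReal_eq (fun p => D.apply_ne_top p), D.tsum_coe, ENNReal.toReal_one] at h

lemma isBelief_or_zero_beliefAt {α : ℝ} (hα0 : 0 < α) (hα1 : α < 1) {D : PMF ℤ}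
    (hD : Summable fun p : ℤ => |(p : ℝ)| * (D p).toReal) (h : List Trade) :
    IsBelief (beliefAt α D h) ∨ beliefAt α D h = 0 := by
  induction h with
  | nil => exact Or.inl (isBelief_prior hD)
  | cons d h ih => exact isBelief_or_zero_nextBelief hα0 hα1 ih d

variable {Ω : Type u}

/-- The list of the first `t` trades in the market. -/
def tradesUpTo (α : ℝ) (D : PMF ℤ) (pext : Ω → ℤ) (trader : ℕ → Ω → Trader) (t : ℕ) (ω : Ω) :
    List Trade :=
  history α D (pext ω) (fun s => trader s ω) t

lemma ask_eq (α : ℝ) (D : PMF ℤ) (pext : Ω → ℤ) (trader : ℕ → Ω → Trader) (t : ℕ) (ω : Ω) :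
    ask α D pext trader t ω = askPrice α (beliefAt α D (tradesUpTo α D pext trader t ω)) := by
  rw [ask, belief_eq_beliefAt, tradesUpTo]

lemma bid_eq (α : ℝ) (D : PMF ℤ) (pext : Ω → ℤ) (trader : ℕ → Ω → Trader) (t : ℕ) (ω : Ω) :
    bid α D pext trader t ω = bidPrice α (beliefAt α D (tradesUpTo α D pext trader t ω)) := by
  rw [bid, belief_eq_beliefAt, tradesUpTo]

/-- The trades of the first `t` slots as a function of the price and the first `t` traders. -/
def historyOfPrefix (α : ℝ) (D : PMF ℤ) (t : ℕ) (z : ℤ × (Finset.range t → Trader)) :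
    List Trade :=
  history α D z.1 (fun s => if hs : s ∈ Finset.range t then z.2 ⟨s, hs⟩ else .informed) t

lemma tradesUpTo_eq_historyOfPrefix (α : ℝ) (D : PMF ℤ) (pext : Ω → ℤ) (trader : ℕ → Ω → Trader)
    (t : ℕ) (ω : Ω) : tradesUpTo α D pext trader t ω =
      historyOfPrefix α D t (pext ω, fun s : Finset.range t => trader s ω) := by
  unfold tradesUpTo historyOfPrefix
  refine history_congr α D _ t fun s hs => ?_
  simp [Finset.mem_range.mpr hs]

/-! ### The law of the next trade and Bayes' rule in the market -/

namespace IsSingleJumpMarket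

variable [MeasurableSpace Ω] {μ : Measure Ω} {α : ℝ} {D : PMF ℤ}
  {pext : Ω → ℤ} {trader : ℕ → Ω → Trader}

/-- The history factors through the price and a finite block of traders, a countable space on which
every function is measurable. -/
lemma measurable_tradesUpTo (hM : IsSingleJumpMarket μ α D pext trader) (t : ℕ) :
    Measurable (tradesUpTo α D pext trader t) := by
  have : tradesUpTo α D pext trader t = fun ω =>
      historyOfPrefix α D t (pext ω, fun s : Finset.range t => trader s ω) :=
    funext fun ω => tradesUpTo_eq_historyOfPrefix α D pext trader t ω
  rw [this]
  have hX : Measurable fun ω (s : Finset.range t) => trader s ω :=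
    measurable_pi_lambda _ fun s => hM.measurable_trader s
  exact (measurable_of_countable (historyOfPrefix α D t)).comp (hM.measurable_pext.prodMk hX)

variable [IsProbabilityMeasure μ]

/-- The price is independent of all traders jointly, and the first `t` traders are independent of
the next one. Hence the joint law of the three is a product, which is then regrouped. -/
lemma indepFun_state_trader (hM : IsSingleJumpMarket μ α D pext trader) (t : ℕ) :
    IndepFun (fun ω => (pext ω, tradesUpTo α D pext trader t ω)) (trader t) μ := by
  have hX : Measurable fun ω (s : Finset.range t) => trader s ω :=
    measurable_pi_lambda _ fun s => hM.measurable_trader s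
  have hY := hM.measurable_trader t
  have h1 : IndepFun (fun ω (s : Finset.range t) => trader s ω) (trader t) μ := by
    have := hM.indep_traders.indepFun_finset (Finset.range t) {t} (by simp) hM.measurable_trader
    exact this.comp measurable_id
      (measurable_pi_apply (⟨t, Finset.mem_singleton_self t⟩ : ({t} : Finset ℕ)))
  have h2 : IndepFun pext (fun ω => ((fun s : Finset.range t => trader s ω), trader t ω)) μ :=
    hM.indep_pext.comp (φ := id)
      (ψ := fun f : ℕ → Trader => ((fun s : Finset.range t => f s), f t)) measurable_id
      ((measurable_pi_lambda _ fun s => measurable_pi_apply _).prodMk (measurable_pi_apply t))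
  have h3 : IndepFun (fun ω => (pext ω, fun s : Finset.range t => trader s ω)) (trader t) μ := by
    rw [indepFun_iff_map_prod_eq_prod_map_map (hM.measurable_pext.prodMk hX).aemeasurable
      hY.aemeasurable]
    rw [indepFun_iff_map_prod_eq_prod_map_map hX.aemeasurable hY.aemeasurable] at h1
    have h4 : IndepFun pext (fun ω (s : Finset.range t) => trader s ω) μ :=
      h2.comp measurable_id measurable_fst
    rw [indepFun_iff_map_prod_eq_prod_map_map hM.measurable_pext.aemeasurable
      hX.aemeasurable] at h4
    rw [indepFun_iff_map_prod_eq_prod_map_map hM.measurable_pext.aemeasurable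
      (hX.prodMk hY).aemeasurable, h1] at h2
    have := Measure.isProbabilityMeasure_map (μ := μ) hM.measurable_pext.aemeasurable
    have := Measure.isProbabilityMeasure_map (μ := μ) hX.aemeasurable
    have := Measure.isProbabilityMeasure_map (μ := μ) hY.aemeasurable
    rw [h4]
    apply (MeasurableEquiv.map_measurableEquiv_injective MeasurableEquiv.prodAssoc)
    rw [Measure.prodAssoc_prod, ← h2, Measure.map_map MeasurableEquiv.prodAssoc.measurable
      ((hM.measurable_pext.prodMk hX).prodMk hY)]
    rfl
  have h5 : (fun ω => (pext ω, tradesUpTo α D pext trader t ω)) =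
      (fun z : ℤ × (Finset.range t → Trader) => (z.1, historyOfPrefix α D t z)) ∘
        fun ω => (pext ω, fun s : Finset.range t => trader s ω) := by
    funext ω
    simp [tradesUpTo_eq_historyOfPrefix]
  rw [h5]
  exact h3.comp (ψ := id) (measurable_of_countable _) measurable_id

lemma lintegral_trader (hM : IsSingleJumpMarket μ α D pext trader) (t : ℕ)
    (G : ℤ × List Trade → Trader → ℝ≥0∞) :
    ∫⁻ ω, G (pext ω, tradesUpTo α D pext trader t ω) (trader t ω) ∂μ =
      ∫⁻ ω, (G (pext ω, tradesUpTo α D pext trader t ω) .informed * ENNReal.ofReal α +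
        (G (pext ω, tradesUpTo α D pext trader t ω) .noiseBuy * ENNReal.ofReal ((1 - α) / 2) +
        G (pext ω, tradesUpTo α D pext trader t ω) .noiseSell * ENNReal.ofReal ((1 - α) / 2)))
          ∂μ := by
  have hZ : Measurable fun ω => (pext ω, tradesUpTo α D pext trader t ω) :=
    hM.measurable_pext.prodMk (hM.measurable_tradesUpTo t)
  have hY := hM.measurable_trader t
  have hind := hM.indepFun_state_trader t
  rw [indepFun_iff_map_prod_eq_prod_map_map hZ.aemeasurable hY.aemeasurable] at hind
  have := Measure.isProbabilityMeasure_map (μ := μ) hY.aemeasurable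
  have := Measure.isProbabilityMeasure_map (μ := μ) hZ.aemeasurable
  have hG : Measurable fun z : (ℤ × List Trade) × Trader => G z.1 z.2 := measurable_of_countable _
  have hlaw : ∀ τ, (μ.map (trader t)) {τ} = μ {ω | trader t ω = τ} := fun τ => by
    rw [Measure.map_apply hY (measurableSet_singleton τ)]; rfl
  calc ∫⁻ ω, G (pext ω, tradesUpTo α D pext trader t ω) (trader t ω) ∂μ
      = ∫⁻ z, G z.1 z.2 ∂(μ.map fun ω => ((pext ω, tradesUpTo α D pext trader t ω), trader t ω)) :=
        (lintegral_map hG (hZ.prodMk hY)).symm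
    _ = ∫⁻ z, ∫⁻ τ, G z τ ∂(μ.map (trader t))
          ∂(μ.map fun ω => (pext ω, tradesUpTo α D pext trader t ω)) := by
        rw [hind, lintegral_prod _ hG.aemeasurable]
    _ = ∫⁻ ω, ∫⁻ τ, G (pext ω, tradesUpTo α D pext trader t ω) τ ∂(μ.map (trader t)) ∂μ :=
        lintegral_map (measurable_of_countable _) hZ
    _ = _ := by
        refine lintegral_congr fun ω => ?_
        rw [lintegral_fintype, sum_trader, hlaw, hlaw, hlaw, hM.prob_informed, hM.prob_noiseBuy,
          hM.prob_noiseSell]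

/-- Expectation over the trader of the next slot. -/
lemma lintegral_succ (hα0 : 0 < α) (hα1 : α < 1) (hM : IsSingleJumpMarket μ α D pext trader)
    (t : ℕ) (F : ℤ → List Trade → ℝ≥0∞) :
    ∫⁻ ω, F (pext ω) (tradesUpTo α D pext trader (t + 1) ω) ∂μ =
      ∫⁻ ω, ∑ d, ENNReal.ofReal
        (like α (beliefAt α D (tradesUpTo α D pext trader t ω)) d (pext ω)) *
          F (pext ω) (d :: tradesUpTo α D pext trader t ω) ∂μ := by
  have := hM.lintegral_trader t fun z τ =>
    F z.1 (action z.1 (askPrice α (beliefAt α D z.2)) (bidPrice α (beliefAt α D z.2)) τ :: z.2)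
  refine this.trans (lintegral_congr fun ω => ?_)
  set b := beliefAt α D (tradesUpTo α D pext trader t ω)
  change F (pext ω) (typ α b (pext ω) :: _) * _ + (F (pext ω) (Trade.buy :: _) * _
    + F (pext ω) (Trade.sell :: _) * _) = _
  rw [sum_trade]
  unfold like
  have hβ : 0 ≤ (1 - α) / 2 := by linarith
  generalize typ α b (pext ω) = τ
  cases τ <;> simp [ENNReal.ofReal_add hα0.le hβ] <;> ring

/-- Bayes' rule: the belief is the conditional law of the price given the trades. -/
lemma lintegral_eq_tsum_belief (hα0 : 0 < α) (hα1 : α < 1)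
    (hD : Summable fun p : ℤ => |(p : ℝ)| * (D p).toReal)
    (hM : IsSingleJumpMarket μ α D pext trader)
    (t : ℕ) (F : ℤ → List Trade → ℝ≥0∞) :
    ∫⁻ ω, F (pext ω) (tradesUpTo α D pext trader t ω) ∂μ =
      ∫⁻ ω, ∑' p, ENNReal.ofReal (beliefAt α D (tradesUpTo α D pext trader t ω) p) *
        F p (tradesUpTo α D pext trader t ω) ∂μ := by
  induction t generalizing F with
  | zero =>
    have h1 : ∀ ω, tradesUpTo α D pext trader 0 ω = [] := fun _ => rfl
    simp only [h1, lintegral_const, measure_univ, mul_one, beliefAt]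
    rw [← lintegral_map (f := fun p => F p []) (measurable_of_countable _) hM.measurable_pext,
      hM.map_pext, lintegral_countable']
    refine tsum_congr fun p => ?_
    rw [PMF.toMeasure_apply_singleton _ _ (measurableSet_singleton p),
      ENNReal.ofReal_toReal (D.apply_ne_top p), mul_comm]
  | succ t ih =>
    -- One step forward, then the induction hypothesis averages out the price. This is used both for
    -- F and for the posterior average of F; the two results agree trade by trade, as evidence times
    -- posterior is likelihood times prior.
    have key : ∀ F : ℤ → List Trade → ℝ≥0∞,
        ∫⁻ ω, F (pext ω) (tradesUpTo α D pext trader (t + 1) ω) ∂μ =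
        ∫⁻ ω, ∑ d, ∑' p, ENNReal.ofReal
          (like α (beliefAt α D (tradesUpTo α D pext trader t ω)) d p *
            beliefAt α D (tradesUpTo α D pext trader t ω) p) *
          F p (d :: tradesUpTo α D pext trader t ω) ∂μ := by
      intro F
      rw [hM.lintegral_succ hα0 hα1 t F]
      rw [ih fun p h => ∑ d, ENNReal.ofReal (like α (beliefAt α D h) d p) * F p (d :: h)]
      refine lintegral_congr fun ω => ?_
      rw [← Summable.tsum_finsetSum fun _ _ => ENNReal.summable]
      refine tsum_congr fun p => ?_
      rw [Finset.mul_sum]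
      refine Finset.sum_congr rfl fun d _ => ?_
      rw [ENNReal.ofReal_mul (like_nonneg hα0 hα1 _ d p)]
      ring
    rw [key F, key fun _ h => ∑' p, ENNReal.ofReal (beliefAt α D h p) * F p h]
    refine lintegral_congr fun ω => Finset.sum_congr rfl fun d _ => ?_
    set h := tradesUpTo α D pext trader t ω
    have hb := isBelief_or_zero_beliefAt hα0 hα1 hD h
    rw [ENNReal.tsum_mul_right]
    have hev : ∑' p, ENNReal.ofReal (like α (beliefAt α D h) d p * beliefAt α D h p)
        = ENNReal.ofReal (evidence α (beliefAt α D h) d) := by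
      rcases hb with hb | hb
      · exact (ENNReal.ofReal_tsum_of_nonneg (fun p => mul_nonneg (like_nonneg hα0 hα1 _ d p)
          (hb.nonneg p)) (summable_like_mul hα0 hα1 hb d)).symm
      · simp [hb, evidence]
    rw [hev, ← ENNReal.tsum_mul_left]
    refine tsum_congr fun p => ?_
    rw [← mul_assoc, ← ENNReal.ofReal_mul (evidence_nonneg hα0 hα1 hb d),
      show beliefAt α D (d :: h) p = nextBelief α 0 (beliefAt α D h) d p from rfl,
      evidence_mul_nextBelief hα0 hα1 hb]

/-- Expectation of a function of the trades over the next trade. -/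
lemma lintegral_succ_evidence (hα0 : 0 < α) (hα1 : α < 1)
    (hD : Summable fun p : ℤ => |(p : ℝ)| * (D p).toReal)
    (hM : IsSingleJumpMarket μ α D pext trader) (t : ℕ) (F : List Trade → ℝ≥0∞) :
    ∫⁻ ω, F (tradesUpTo α D pext trader (t + 1) ω) ∂μ =
      ∫⁻ ω, ∑ d, ENNReal.ofReal
        (evidence α (beliefAt α D (tradesUpTo α D pext trader t ω)) d) *
          F (d :: tradesUpTo α D pext trader t ω) ∂μ := by
  rw [hM.lintegral_succ hα0 hα1 t fun _ h => F h, hM.lintegral_eq_tsum_belief hα0 hα1 hD t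
    fun p h => ∑ d, ENNReal.ofReal (like α (beliefAt α D h) d p) * F (d :: h)]
  refine lintegral_congr fun ω => ?_
  set h := tradesUpTo α D pext trader t ω
  simp only [Finset.mul_sum]
  rw [Summable.tsum_finsetSum fun _ _ => ENNReal.summable]
  refine Finset.sum_congr rfl fun d _ => ?_
  simp only [← mul_assoc]
  rw [ENNReal.tsum_mul_right]
  congr 1
  have hb := isBelief_or_zero_beliefAt hα0 hα1 hD h
  rcases hb with hb | hb
  · rw [evidence, ENNReal.ofReal_tsum_of_nonneg (fun p => mul_nonneg (like_nonneg hα0 hα1 _ d p)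
          (hb.nonneg p)) (summable_like_mul hα0 hα1 hb d)]
    refine tsum_congr fun p => ?_
    rw [mul_comm, ENNReal.ofReal_mul (like_nonneg hα0 hα1 _ d p)]
  · simp [hb, evidence]

/-- Bayes' rule applied to the indicator of zero belief weight: each such price is itself weighted
by zero. -/
lemma ae_beliefAt_pext_ne_zero (hα0 : 0 < α) (hα1 : α < 1)
    (hD : Summable fun p : ℤ => |(p : ℝ)| * (D p).toReal)
    (hM : IsSingleJumpMarket μ α D pext trader) (t : ℕ) :
    ∀ᵐ ω ∂μ, beliefAt α D (tradesUpTo α D pext trader t ω) (pext ω) ≠ 0 := by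
  classical
  have h := hM.lintegral_eq_tsum_belief hα0 hα1 hD t
    fun p h => if beliefAt α D h p = 0 then 1 else 0
  have h0 : ∀ ω, ∑' p, ENNReal.ofReal (beliefAt α D (tradesUpTo α D pext trader t ω) p) *
      (if beliefAt α D (tradesUpTo α D pext trader t ω) p = 0 then 1 else 0) = 0 := by
    intro ω
    rw [ENNReal.tsum_eq_zero]
    intro p
    split_ifs with hp <;> simp [hp]
  simp only [h0, lintegral_zero] at h
  have hmeas : Measurable fun ω =>
      if beliefAt α D (tradesUpTo α D pext trader t ω) (pext ω) = 0 then (1 : ℝ≥0∞) else 0 :=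
    (measurable_of_countable fun z : ℤ × List Trade =>
      if beliefAt α D z.2 z.1 = 0 then (1 : ℝ≥0∞) else 0).comp
      (hM.measurable_pext.prodMk (hM.measurable_tradesUpTo t))
  rw [lintegral_eq_zero_iff hmeas] at h
  filter_upwards [h] with ω hω h1
  simp [h1] at hω

lemma ae_isBelief (hα0 : 0 < α) (hα1 : α < 1)
    (hD : Summable fun p : ℤ => |(p : ℝ)| * (D p).toReal)
    (hM : IsSingleJumpMarket μ α D pext trader) (t : ℕ) :
    ∀ᵐ ω ∂μ, IsBelief (beliefAt α D (tradesUpTo α D pext trader t ω)) := by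
  filter_upwards [hM.ae_beliefAt_pext_ne_zero hα0 hα1 hD t] with ω hω
  refine (isBelief_or_zero_beliefAt hα0 hα1 hD _).resolve_right fun h => hω ?_
  rw [h]; rfl

end IsSingleJumpMarket

/-! ### Hellinger overlaps of pairs of prices -/

/-- The geometric mean of the weights of two prices whose informed traders act differently. -/
def sepOverlap (α : ℝ) (b : ℤ → ℝ) (p q : ℤ) : ℝ :=
  if typ α b p = typ α b q then 0 else √(b p * b q)

/-- A bound for the affinity of the trade laws of two prices told apart by the quotes. -/
def affinity (α : ℝ) : ℝ := 1 / 2 + √((1 - α) / 2 * ((1 + α) / 2))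

lemma typ_eq_buy_iff {α : ℝ} {b : ℤ → ℝ} {p : ℤ} : typ α b p = .buy ↔ askPrice α b < p := by
  unfold typ action; split_ifs <;> simp_all

lemma typ_eq_sell_iff {α : ℝ} (hα0 : 0 < α) (hα1 : α < 1) {b : ℤ → ℝ} (hb : IsBelief b) {p : ℤ} :
    typ α b p = .sell ↔ p < bidPrice α b := by
  have := hb.bidPrice_le_askPrice hα0 hα1
  simp only [typ, action]
  split_ifs with h1 h2
  · simp; linarith
  · simpa using h2
  · simpa using h2

lemma sqrt_mul_lt_half {α : ℝ} (hα0 : 0 < α) : √((1 - α) / 2 * ((1 + α) / 2)) < 1 / 2 := by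
  rw [Real.sqrt_lt' (by norm_num)]
  nlinarith [mul_pos hα0 hα0]

lemma sepOverlap_nonneg (α : ℝ) (b : ℤ → ℝ) (p q : ℤ) : 0 ≤ sepOverlap α b p q := by
  unfold sepOverlap; split_ifs <;> positivity

lemma affinity_lt_one {α : ℝ} (hα0 : 0 < α) : affinity α < 1 := by
  have := sqrt_mul_lt_half hα0
  unfold affinity; linarith

section Affinity

variable {α : ℝ} (hα0 : 0 < α) (hα1 : α < 1)
include hα0 hα1

/-- With s = √((1-α)/2·(1+α)/2) < 1/2, the affinity of differing trade laws is 2s for buy against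
sell, and s + (1-α)/2 when one side does not trade. Both are at most 1/2 + s. -/
lemma sum_sqrt_like_le (b : ℤ → ℝ) (p q : ℤ) :
    ∑ d, √(like α b d p * like α b d q) ≤
      if typ α b p = typ α b q then 1 else affinity α := by
  have hs := sqrt_mul_lt_half hα0
  have e1 : √((1 - α) / 2 * (α + (1 - α) / 2)) = √((1 - α) / 2 * ((1 + α) / 2)) := by
    congr 1; ring
  have e2 : √((α + (1 - α) / 2) * ((1 - α) / 2)) = √((1 - α) / 2 * ((1 + α) / 2)) := by
    congr 1; ring
  have e3 : √((α + (1 - α) / 2) * (α + (1 - α) / 2)) = α + (1 - α) / 2 :=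
    Real.sqrt_mul_self (by linarith)
  have e4 : √((1 - α) / 2 * ((1 - α) / 2)) = (1 - α) / 2 := Real.sqrt_mul_self (by linarith)
  have e5 : √(α * α) = α := Real.sqrt_mul_self hα0.le
  rw [sum_trade]
  unfold like affinity
  generalize typ α b p = x
  generalize typ α b q = y
  cases x <;> cases y <;> simp [e1, e2, e3, e4, e5] <;> linarith

lemma evidence_mul_sqrt {b : ℤ → ℝ} (hb : IsBelief b ∨ b = 0) (d : Trade) (p q : ℤ) :
    evidence α b d * √(nextBelief α 0 b d p * nextBelief α 0 b d q)
      = √(like α b d p * like α b d q) * √(b p * b q) := by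
  have hK := evidence_nonneg hα0 hα1 hb d
  rw [← Real.sqrt_mul (mul_nonneg (like_nonneg hα0 hα1 b d p) (like_nonneg hα0 hα1 b d q)),
    show like α b d p * like α b d q * (b p * b q)
      = (like α b d p * b p) * (like α b d q * b q) by ring,
    ← evidence_mul_nextBelief hα0 hα1 hb, ← evidence_mul_nextBelief hα0 hα1 hb,
    show evidence α b d * nextBelief α 0 b d p * (evidence α b d * nextBelief α 0 b d q)
      = evidence α b d ^ 2 * (nextBelief α 0 b d p * nextBelief α 0 b d q) by ring,
    Real.sqrt_mul (sq_nonneg _), Real.sqrt_sq hK]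

/-- The supermartingale inequality: the normalization cancels against the predictive probability of
the trade, leaving the affinity of the two trade laws as the factor. -/
lemma sum_evidence_mul_sqrt_le {b : ℤ → ℝ} (hb : IsBelief b ∨ b = 0) (p q : ℤ) :
    ∑ d, evidence α b d * √(nextBelief α 0 b d p * nextBelief α 0 b d q) +
      (1 - affinity α) * sepOverlap α b p q ≤ √(b p * b q) := by
  simp only [evidence_mul_sqrt hα0 hα1 hb]
  rw [← Finset.sum_mul]
  have h := sum_sqrt_like_le hα0 hα1 b p q
  have hs := Real.sqrt_nonneg (b p * b q)
  unfold sepOverlap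
  split_ifs at h ⊢
  · nlinarith
  · nlinarith

end Affinity

lemma IsBelief.le_one {b : ℤ → ℝ} (hb : IsBelief b) (p : ℤ) : b p ≤ 1 :=
  le_hasSum hb.hasSum p fun q _ => hb.nonneg q

lemma sqrt_overlap_le_one {b : ℤ → ℝ} (hb : IsBelief b ∨ b = 0) (p q : ℤ) :
    √(b p * b q) ≤ 1 := by
  rcases hb with hb | rfl
  · exact Real.sqrt_le_one.mpr (mul_le_one₀ (hb.le_one p) (hb.nonneg q) (hb.le_one q))
  · simp

lemma IsBelief.upside_eq_zero_iff {b : ℤ → ℝ} (hb : IsBelief b) (x : ℝ) :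
    upside b x = 0 ↔ ∀ p : ℤ, x < p → b p = 0 := by
  have h0 := hasSum_zero_iff_of_nonneg (L := .unconditional ℤ) (f := fun p : ℤ => max ((p : ℝ) - x) 0 * b p)
    fun p => mul_nonneg (le_max_right _ _) (hb.nonneg p)
  have h1 : upside b x = 0 ↔ HasSum (fun p : ℤ => max ((p : ℝ) - x) 0 * b p) 0 :=
    ⟨fun h => by have := (hb.summable_upside x).hasSum; rwa [← upside, h] at this,
      fun h => h.tsum_eq⟩
  rw [h1, h0]
  constructor
  · intro h p hp
    have := congrFun h p
    simp only [Pi.zero_apply, mul_eq_zero] at this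
    refine this.resolve_left fun h => ?_
    rw [max_eq_left (by linarith)] at h
    linarith
  · intro h
    funext p
    rcases lt_or_ge x (p : ℝ) with hp | hp
    · simp [h p hp]
    · simp [max_eq_right (show (p : ℝ) - x ≤ 0 by linarith)]

lemma IsBelief.downside_eq_zero_iff {b : ℤ → ℝ} (hb : IsBelief b) (x : ℝ) :
    downside b x = 0 ↔ ∀ p : ℤ, p < x → b p = 0 := by
  have h := hb.neg.upside_eq_zero_iff (-x)
  rw [IsBelief.upside_neg, neg_neg] at h
  rw [h]
  constructor
  · intro h p hp
    simpa using h (-p) (by push_cast; linarith)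
  · intro h p hp
    exact h (-p) (by push_cast; linarith)

/-- A limit of beliefs whose quotes asymptotically do not tell prices apart is concentrated on a
single price. -/
lemma IsBelief.eq_of_tendsto {α : ℝ} (hα0 : 0 < α) (hα1 : α < 1) {b : ℤ → ℝ} (hb : IsBelief b)
    {c : ℕ → ℤ → ℝ} (hc : ∀ n, IsBelief (c n))
    (hlim : ∀ p, Tendsto (fun n => c n p) atTop (𝓝 (b p)))
    (hU : ∀ k : ℤ, Tendsto (fun n => upside (c n) k) atTop (𝓝 (upside b k)))
    (hDn : ∀ k : ℤ, Tendsto (fun n => downside (c n) k) atTop (𝓝 (downside b k)))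
    (hsep : ∀ p q : ℤ, Tendsto (fun n => sepOverlap α (c n) p q) atTop (𝓝 0))
    {p q : ℤ} (hp : b p ≠ 0) (hq : b q ≠ 0) : p = q := by
  by_contra hpq
  set a := askPrice α b with ha
  have hbal := hb.askPrice_balance hα0 hα1
  rw [← ha] at hbal
  -- If both deviations vanished, `b` would sit at the single point `a`. By the balance at the ask
  -- neither then vanishes alone, so there are atoms s < a < r.
  have hzero : ¬ (upside b a = 0 ∧ downside b a = 0) := by
    rintro ⟨h1, h2⟩
    rw [hb.upside_eq_zero_iff] at h1
    rw [hb.downside_eq_zero_iff] at h2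
    have key : ∀ r : ℤ, b r ≠ 0 → (r : ℝ) = a := fun r hr =>
      le_antisymm (not_lt.mp fun h => hr (h1 r h)) (not_lt.mp fun h => hr (h2 r h))
    exact hpq (by exact_mod_cast (key p hp).trans (key q hq).symm)
  have hU0 : upside b a ≠ 0 := fun h => by
    rw [h, mul_zero] at hbal
    have h' := mul_eq_zero.mp hbal.symm
    exact hzero ⟨h, h'.resolve_left (by linarith)⟩
  have hD0 : downside b a ≠ 0 := fun h => by
    rw [h, mul_zero] at hbal
    have h' := mul_eq_zero.mp hbal
    exact hzero ⟨h'.resolve_left (by linarith), h⟩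
  rw [Ne, hb.upside_eq_zero_iff] at hU0
  rw [Ne, hb.downside_eq_zero_iff] at hD0
  push Not at hU0 hD0
  obtain ⟨r, hra, hr⟩ := hU0
  obtain ⟨s, hsa, hs⟩ := hD0
  rw [hb.askPrice_lt_iff hα0 hα1] at hra
  rw [hb.lt_askPrice_iff hα0 hα1] at hsa
  -- The strict inequalities at the integers r and s pass to `c n` for large n, so its ask also
  -- falls strictly between s and r and separates them.
  have h1 := ((hU r).const_mul ((1 + α) / 2)).eventually_lt ((hDn r).const_mul ((1 - α) / 2)) hra
  have h2 := ((hDn s).const_mul ((1 - α) / 2)).eventually_lt ((hU s).const_mul ((1 + α) / 2)) hsa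
  have h3 : Tendsto (fun n => √(c n s * c n r)) atTop (𝓝 (√(b s * b r))) :=
    ((hlim s).mul (hlim r)).sqrt
  have h4 : Tendsto (fun n => √(c n s * c n r)) atTop (𝓝 0) := by
    refine (hsep s r).congr' ?_
    filter_upwards [h1, h2] with n hn1 hn2
    rw [← (hc n).askPrice_lt_iff hα0 hα1] at hn1
    rw [← (hc n).lt_askPrice_iff hα0 hα1] at hn2
    rw [sepOverlap, if_neg]
    rw [typ_eq_buy_iff.mpr hn1, typ_eq_buy_iff]
    exact not_lt.mpr hn2.le
  have h5 := tendsto_nhds_unique h3 h4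
  have hs' := lt_of_le_of_ne (hb.nonneg s) hs.symm
  have hr' := lt_of_le_of_ne (hb.nonneg r) hr.symm
  exact (Real.sqrt_pos.mpr (mul_pos hs' hr')).ne' h5

namespace IsSingleJumpMarket

variable [MeasurableSpace Ω] {μ : Measure Ω} {α : ℝ} {D : PMF ℤ}
  {pext : Ω → ℤ} {trader : ℕ → Ω → Trader}

lemma measurable_comp_tradesUpTo (hM : IsSingleJumpMarket μ α D pext trader) (t : ℕ)
    {E : Type*} [MeasurableSpace E] (F : List Trade → E) :
    Measurable fun ω => F (tradesUpTo α D pext trader t ω) :=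
  (measurable_of_countable F).comp (hM.measurable_tradesUpTo t)

variable [IsProbabilityMeasure μ] (hα0 : 0 < α) (hα1 : α < 1)
  (hD : Summable fun p : ℤ => |(p : ℝ)| * (D p).toReal)
  (hM : IsSingleJumpMarket μ α D pext trader)
include hα0 hα1 hD hM

lemma lintegral_overlap_succ_add_le (t : ℕ) (p q : ℤ) :
    ∫⁻ ω, ENNReal.ofReal √(beliefAt α D (tradesUpTo α D pext trader (t + 1) ω) p *
        beliefAt α D (tradesUpTo α D pext trader (t + 1) ω) q) ∂μ +
      ∫⁻ ω, ENNReal.ofReal ((1 - affinity α) *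
        sepOverlap α (beliefAt α D (tradesUpTo α D pext trader t ω)) p q) ∂μ ≤
    ∫⁻ ω, ENNReal.ofReal √(beliefAt α D (tradesUpTo α D pext trader t ω) p *
        beliefAt α D (tradesUpTo α D pext trader t ω) q) ∂μ := by
  rw [hM.lintegral_succ_evidence hα0 hα1 hD t
    fun h => ENNReal.ofReal √(beliefAt α D h p * beliefAt α D h q),
    ← lintegral_add_right _ (hM.measurable_comp_tradesUpTo t fun h =>
      ENNReal.ofReal ((1 - affinity α) * sepOverlap α (beliefAt α D h) p q))]
  refine lintegral_mono fun ω => ?_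
  set h := tradesUpTo α D pext trader t ω
  have hb := isBelief_or_zero_beliefAt hα0 hα1 hD h
  have h1 : ∀ d, 0 ≤ evidence α (beliefAt α D h) d *
      √(beliefAt α D (d :: h) p * beliefAt α D (d :: h) q) := fun d =>
    mul_nonneg (evidence_nonneg hα0 hα1 hb d) (Real.sqrt_nonneg _)
  have h2 : 0 ≤ (1 - affinity α) * sepOverlap α (beliefAt α D h) p q :=
    mul_nonneg (by linarith [affinity_lt_one hα0]) (sepOverlap_nonneg α _ _ _)
  simp only [← ENNReal.ofReal_mul (evidence_nonneg hα0 hα1 hb _)]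
  rw [← ENNReal.ofReal_sum_of_nonneg fun d _ => h1 d,
    ← ENNReal.ofReal_add (Finset.sum_nonneg fun d _ => h1 d) h2]
  exact ENNReal.ofReal_le_ofReal (sum_evidence_mul_sqrt_le hα0 hα1 hb p q)

/-- The expected losses of the supermartingale telescope and sum to at most its initial value, so
the separated overlaps are almost surely summable. -/
lemma ae_tendsto_sepOverlap (p q : ℤ) :
    ∀ᵐ ω ∂μ, Tendsto (fun t => sepOverlap α
      (beliefAt α D (tradesUpTo α D pext trader t ω)) p q) atTop (𝓝 0) := by
  set S : ℕ → ℝ≥0∞ := fun t => ∫⁻ ω, ENNReal.ofReal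
    √(beliefAt α D (tradesUpTo α D pext trader t ω) p *
        beliefAt α D (tradesUpTo α D pext trader t ω) q) ∂μ with hS
  set f : ℕ → Ω → ℝ≥0∞ := fun t ω => ENNReal.ofReal ((1 - affinity α) *
        sepOverlap α (beliefAt α D (tradesUpTo α D pext trader t ω)) p q) with hf
  have hstep : ∀ t, S (t + 1) + ∫⁻ ω, f t ω ∂μ ≤ S t := fun t =>
    hM.lintegral_overlap_succ_add_le hα0 hα1 hD t p q
  have hsum : ∀ t, S t + ∑ s ∈ Finset.range t, ∫⁻ ω, f s ω ∂μ ≤ S 0 := by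
    intro t
    induction t with
    | zero => simp
    | succ t ih =>
      rw [Finset.sum_range_succ, add_comm (∑ s ∈ _, _), ← add_assoc]
      exact (add_le_add_left (hstep t) _).trans ih
  have hS0 : S 0 ≤ 1 := by
    calc S 0 ≤ ∫⁻ _, 1 ∂μ := lintegral_mono fun ω => by
          rw [← ENNReal.ofReal_one]
          exact ENNReal.ofReal_le_ofReal
            (sqrt_overlap_le_one (isBelief_or_zero_beliefAt hα0 hα1 hD _) p q)
      _ = 1 := by simp
  have hfm : ∀ t, Measurable (f t) := fun t =>
    hM.measurable_comp_tradesUpTo t fun h =>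
      ENNReal.ofReal ((1 - affinity α) * sepOverlap α (beliefAt α D h) p q)
  have hfin : ∫⁻ ω, ∑' t, f t ω ∂μ ≠ ∞ := by
    rw [lintegral_tsum fun t => (hfm t).aemeasurable]
    refine ne_top_of_le_ne_top ENNReal.one_ne_top (ENNReal.tsum_le_of_sum_range_le fun t => ?_)
    exact (le_add_self.trans (hsum t)).trans hS0
  filter_upwards [ae_lt_top' (AEMeasurable.tsum fun t => (hfm t).aemeasurable) hfin]
    with ω hω
  have h1 := ENNReal.tendsto_atTop_zero_of_tsum_ne_top hω.ne
  have h2 := (ENNReal.tendsto_toReal ENNReal.zero_ne_top).comp h1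
  have ha : 0 < 1 - affinity α := by linarith [affinity_lt_one hα0]
  have h3 : ∀ t, (f t ω).toReal = (1 - affinity α) *
        sepOverlap α (beliefAt α D (tradesUpTo α D pext trader t ω)) p q := fun t =>
    ENNReal.toReal_ofReal (mul_nonneg ha.le (sepOverlap_nonneg α _ _ _))
  have h4 := h2.const_mul (1 - affinity α)⁻¹
  simp only [Function.comp_def, h3, ENNReal.toReal_zero, mul_zero, inv_mul_cancel_left₀ ha.ne']
    at h4
  exact h4

end IsSingleJumpMarket

/-! ### Convergence of beliefs to the conditional law given all trades -/

lemma hasSum_real_singleton_mul {ν : Measure ℤ} [IsFiniteMeasure ν] {f : ℤ → ℝ}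
    (hf : Integrable f ν) : HasSum (fun p => f p * ν.real {p}) (∫ p, f p ∂ν) := by
  have hs : Measure.sum (fun p : ℤ => ν {p} • Measure.dirac p) = ν := Measure.sum_smul_dirac ν
  rw [← hs] at hf
  have h := hasSum_integral_measure hf
  rw [hs] at h
  refine h.congr_fun fun p => ?_
  rw [integral_smul_measure, integral_dirac, smul_eq_mul, mul_comm]
  rfl

/-- The point masses of a probability measure on `ℤ` with finite mean form a belief. -/
lemma isBelief_of_measure {ν : Measure ℤ} [IsProbabilityMeasure ν]
    (hν : Integrable (fun p : ℤ => |(p : ℝ)|) ν) : IsBelief fun p => ν.real {p} where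
  nonneg _ := measureReal_nonneg
  summable_abs := (hasSum_real_singleton_mul hν).summable
  hasSum := by
    have := hasSum_real_singleton_mul (integrable_const (μ := ν) (1 : ℝ))
    simpa using this

lemma tsum_mul_beliefAt_nonneg {α : ℝ} (hα0 : 0 < α) (hα1 : α < 1) {D : PMF ℤ}
    (hD : Summable fun p : ℤ => |(p : ℝ)| * (D p).toReal) {f : ℤ → ℝ} (hf0 : ∀ p, 0 ≤ f p) (h : List Trade) :
    0 ≤ ∑' p, f p * beliefAt α D h p := by
  rcases isBelief_or_zero_beliefAt hα0 hα1 hD h with hb | hb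
  · exact tsum_nonneg fun p => mul_nonneg (hf0 p) (hb.nonneg p)
  · simp [hb]

namespace IsSingleJumpMarket

variable [MeasurableSpace Ω] {μ : Measure Ω} {α : ℝ} {D : PMF ℤ}
  {pext : Ω → ℤ} {trader : ℕ → Ω → Trader}

/-- The information of the market maker. -/
def trades (hM : IsSingleJumpMarket μ α D pext trader) : Filtration ℕ ‹MeasurableSpace Ω› where
  seq t := MeasurableSpace.comap (tradesUpTo α D pext trader t) inferInstance
  mono' := by
    refine monotone_nat_of_le_succ fun t => ?_
    have h : tradesUpTo α D pext trader t = List.tail ∘ tradesUpTo α D pext trader (t + 1) := by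
      funext ω; rfl
    rw [h, ← MeasurableSpace.comap_comp]
    exact MeasurableSpace.comap_mono (measurable_of_countable List.tail).comap_le
  le' t := (hM.measurable_tradesUpTo t).comap_le

lemma iSup_trades (hM : IsSingleJumpMarket μ α D pext trader) :
    ⨆ t, hM.trades t =
      MeasurableSpace.comap (fun ω t => tradesUpTo α D pext trader t ω) inferInstance := by
  simp only [MeasurableSpace.pi, MeasurableSpace.comap_iSup, MeasurableSpace.comap_comp]
  rfl

lemma measurable_allTrades (hM : IsSingleJumpMarket μ α D pext trader) :
    Measurable fun ω t => tradesUpTo α D pext trader t ω :=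
  measurable_pi_lambda _ hM.measurable_tradesUpTo

variable [IsProbabilityMeasure μ]

/-- The conditional law of the price given all trades. -/
def limitLaw (_ : IsSingleJumpMarket μ α D pext trader) (ω : Ω) : Measure ℤ :=
  condDistrib pext (fun ω t => tradesUpTo α D pext trader t ω) μ
    (fun t => tradesUpTo α D pext trader t ω)

instance (hM : IsSingleJumpMarket μ α D pext trader) (ω : Ω) :
    IsProbabilityMeasure (hM.limitLaw ω) := by
  unfold limitLaw; infer_instance

/-- The event that the limit law misses p is determined by the trades, and on it the conditional
probability of `pext = p` is zero; countably many p suffice. -/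
lemma ae_limitLaw_pext_ne_zero (hM : IsSingleJumpMarket μ α D pext trader) :
    ∀ᵐ ω ∂μ, (hM.limitLaw ω).real {pext ω} ≠ 0 := by
  have key : ∀ p : ℤ, ∀ᵐ ω ∂μ, pext ω = p → (hM.limitLaw ω).real {p} ≠ 0 := by
    intro p
    have h := condDistrib_ae_eq_condExp (μ := μ) hM.measurable_allTrades hM.measurable_pext
      (measurableSet_singleton p)
    set X : Ω → ℕ → List Trade := fun ω t => tradesUpTo α D pext trader t ω with hX
    have hXm : Measurable X := hM.measurable_allTrades
    have hm : MeasurableSpace.comap X inferInstance ≤ ‹MeasurableSpace Ω› := hXm.comap_le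
    set T : Set (ℕ → List Trade) := {x | (condDistrib pext X μ x).real {p} = 0} with hT
    have hTm : MeasurableSet T := by
      have : Measurable fun x => (condDistrib pext X μ x).real {p} :=
        (Kernel.measurable_coe _ (measurableSet_singleton p)).ennreal_toReal
      exact this (measurableSet_singleton 0)
    have hA : MeasurableSet[MeasurableSpace.comap X inferInstance] (X ⁻¹' T) := ⟨T, hTm, rfl⟩
    have hp : MeasurableSet (pext ⁻¹' {p}) := hM.measurable_pext (measurableSet_singleton p)
    have hi : Integrable ((pext ⁻¹' {p}).indicator fun _ => (1 : ℝ)) μ :=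
      (integrable_const 1).indicator hp
    have h1 := setIntegral_condExp hm hi hA
    have h2 : ∫ ω in X ⁻¹' T, (μ[(pext ⁻¹' {p}).indicator fun _ => (1 : ℝ) |
        MeasurableSpace.comap X inferInstance]) ω ∂μ = 0 := by
      have h4 : ∀ᵐ ω ∂μ, ω ∈ X ⁻¹' T → (μ[(pext ⁻¹' {p}).indicator fun _ => (1 : ℝ) |
          MeasurableSpace.comap X inferInstance]) ω = 0 := by
        filter_upwards [h] with ω hω hωT
        rw [← hω]
        exact hωT
      rw [setIntegral_congr_ae (hm _ hA) h4, integral_zero]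
    rw [h2, setIntegral_indicator hp] at h1
    simp only [integral_const, MeasurableSet.univ, measureReal_restrict_apply, Set.univ_inter,
      smul_eq_mul, mul_one] at h1
    have h3 : μ (X ⁻¹' T ∩ pext ⁻¹' {p}) = 0 := by
      rw [eq_comm, measureReal_eq_zero_iff] at h1
      exact h1
    rw [ae_iff]
    refine measure_mono_null (fun ω hω => ?_) h3
    simp only [Set.mem_ofPred_eq, not_forall, not_not] at hω
    exact ⟨hω.2, hω.1⟩
  filter_upwards [ae_all_iff.mpr key] with ω hω
  exact hω _ rfl

section

variable (hα0 : 0 < α) (hα1 : α < 1)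
  (hD : Summable fun p : ℤ => |(p : ℝ)| * (D p).toReal)
  (hM : IsSingleJumpMarket μ α D pext trader)
include hα0 hα1 hD hM

lemma setLIntegral_price {f : ℤ → ℝ} (hf0 : ∀ p, 0 ≤ f p) {A B : ℝ}
    (hf : ∀ p : ℤ, |f p| ≤ A + B * |(p : ℝ)|) (t : ℕ) (S : Set (List Trade)) :
    ∫⁻ ω in tradesUpTo α D pext trader t ⁻¹' S, ENNReal.ofReal (f (pext ω)) ∂μ =
      ∫⁻ ω in tradesUpTo α D pext trader t ⁻¹' S,
        ENNReal.ofReal (∑' p, f p * beliefAt α D (tradesUpTo α D pext trader t ω) p) ∂μ := by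
  have hS : MeasurableSet (tradesUpTo α D pext trader t ⁻¹' S) :=
    hM.measurable_tradesUpTo t (MeasurableSet.of_discrete)
  rw [← lintegral_indicator hS, ← lintegral_indicator hS]
  have h := hM.lintegral_eq_tsum_belief hα0 hα1 hD t
    fun p h => S.indicator (fun _ => ENNReal.ofReal (f p)) h
  refine h.trans (lintegral_congr fun ω => ?_)
  by_cases hω : tradesUpTo α D pext trader t ω ∈ S
  · rw [Set.indicator_of_mem (by exact hω)]
    simp only [Set.indicator_of_mem hω]
    set h := tradesUpTo α D pext trader t ω
    rcases isBelief_or_zero_beliefAt hα0 hα1 hD h with hb | hb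
    · rw [ENNReal.ofReal_tsum_of_nonneg (fun p => mul_nonneg (hf0 p) (hb.nonneg p))
        (hb.summable_mul A B hf)]
      refine tsum_congr fun p => ?_
      rw [ENNReal.ofReal_mul (hf0 p), mul_comm]
    · simp [hb]
  · rw [Set.indicator_of_notMem (by exact hω)]
    simp [Set.indicator_of_notMem hω]

lemma integrable_price {f : ℤ → ℝ} (hf0 : ∀ p, 0 ≤ f p) {A B : ℝ}
    (hf : ∀ p : ℤ, |f p| ≤ A + B * |(p : ℝ)|) : Integrable (fun ω => f (pext ω)) μ := by
  refine ⟨((measurable_of_countable f).comp hM.measurable_pext).aestronglyMeasurable, ?_⟩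
  rw [hasFiniteIntegral_iff_ofReal (ae_of_all _ fun ω => hf0 _)]
  have h := hM.setLIntegral_price hα0 hα1 hD hf0 hf 0 Set.univ
  simp only [Set.preimage_univ, Measure.restrict_univ] at h
  rw [h]
  have h1 : ∀ ω, tradesUpTo α D pext trader 0 ω = [] := fun _ => rfl
  simp only [h1, lintegral_const, measure_univ, mul_one]
  exact ENNReal.ofReal_lt_top

/-- Bayes' rule tested on events of the trade filtration. It makes expectations under the beliefs a
closed martingale, to which Lévy's theorem applies. -/
lemma condExp_price {f : ℤ → ℝ} (hf0 : ∀ p, 0 ≤ f p) {A B : ℝ}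
    (hf : ∀ p : ℤ, |f p| ≤ A + B * |(p : ℝ)|) (t : ℕ) :
    (fun ω => ∑' p, f p * beliefAt α D (tradesUpTo α D pext trader t ω) p)
      =ᵐ[μ] μ[fun ω => f (pext ω) | hM.trades t] := by
  have hint := hM.integrable_price hα0 hα1 hD hf0 hf
  have hφ : Measurable[hM.trades t]
      (fun ω => ∑' p, f p * beliefAt α D (tradesUpTo α D pext trader t ω) p) :=
    (measurable_of_countable fun h => ∑' p, f p * beliefAt α D h p).comp
      (comap_measurable (tradesUpTo α D pext trader t))
  have hφ' := hφ.mono ((hM.trades).le t) le_rfl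
  have hg0 : ∀ ω, 0 ≤ ∑' p, f p * beliefAt α D (tradesUpTo α D pext trader t ω) p := fun ω =>
    tsum_mul_beliefAt_nonneg hα0 hα1 hD hf0 _
  have hgint : Integrable
      (fun ω => ∑' p, f p * beliefAt α D (tradesUpTo α D pext trader t ω) p) μ := by
    refine ⟨hφ'.aestronglyMeasurable, ?_⟩
    rw [hasFiniteIntegral_iff_ofReal (ae_of_all _ hg0)]
    have h := hM.setLIntegral_price hα0 hα1 hD hf0 hf t Set.univ
    simp only [Set.preimage_univ, Measure.restrict_univ] at h
    rw [← h, ← hasFiniteIntegral_iff_ofReal (ae_of_all _ fun ω => hf0 _)]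
    exact hint.2
  refine ae_eq_condExp_of_forall_setIntegral_eq ((hM.trades).le t) hint
    (fun s _ _ => hgint.integrableOn) ?_ hφ.stronglyMeasurable.aestronglyMeasurable
  rintro s ⟨S, -, rfl⟩ -
  rw [integral_eq_lintegral_of_nonneg_ae (ae_of_all _ hg0)
      hφ'.aestronglyMeasurable,
    integral_eq_lintegral_of_nonneg_ae (ae_of_all _ fun ω => hf0 _) hint.1.restrict,
    hM.setLIntegral_price hα0 hα1 hD hf0 hf t S]

lemma ae_integrable_limitLaw :
    ∀ᵐ ω ∂μ, Integrable (fun p : ℤ => |(p : ℝ)|) (hM.limitLaw ω) := by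
  have h := hM.integrable_price hα0 hα1 hD (f := fun p => |(p : ℝ)|) (A := 0) (B := 1)
    (fun p => abs_nonneg _) (fun p => by simp)
  refine Integrable.condDistrib_ae (f := fun z : (ℕ → List Trade) × ℤ => |(z.2 : ℝ)|)
    hM.measurable_allTrades.aemeasurable hM.measurable_pext.aemeasurable ?_
  rw [integrable_map_measure]
  · exact h
  · exact ((measurable_of_countable fun p : ℤ => |(p : ℝ)|).comp
      measurable_snd).aestronglyMeasurable
  · exact (hM.measurable_allTrades.prodMk hM.measurable_pext).aemeasurable

/-- Expectations under the beliefs converge to those under the conditional law given all trades. -/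
lemma ae_tendsto_tsum_belief {f : ℤ → ℝ} (hf0 : ∀ p, 0 ≤ f p) {A B : ℝ}
    (hf : ∀ p : ℤ, |f p| ≤ A + B * |(p : ℝ)|) :
    ∀ᵐ ω ∂μ, Tendsto
      (fun t => ∑' p, f p * beliefAt α D (tradesUpTo α D pext trader t ω) p) atTop
      (𝓝 (∑' p, f p * (hM.limitLaw ω).real {p})) := by
  have hint := hM.integrable_price hα0 hα1 hD hf0 hf
  have h1 := tendsto_ae_condExp (μ := μ) (ℱ := hM.trades) fun ω => f (pext ω)
  have h2 := ae_all_iff.mpr fun t => hM.condExp_price hα0 hα1 hD hf0 hf t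
  have h3 := condExp_ae_eq_integral_condDistrib (μ := μ) (f := f) hM.measurable_allTrades
    hM.measurable_pext.aemeasurable (measurable_of_countable f).stronglyMeasurable hint
  rw [← hM.iSup_trades] at h3
  filter_upwards [h1, h2, h3, hM.ae_integrable_limitLaw hα0 hα1 hD] with ω hω1 hω2 hω3 hω4
  rw [hω3] at hω1
  have hfi : Integrable f (hM.limitLaw ω) := by
    refine Integrable.mono' ((integrable_const A).add (hω4.const_mul B))
      (measurable_of_countable f).aestronglyMeasurable (ae_of_all _ fun p => ?_)
    exact hf p
  rw [(hasSum_real_singleton_mul hfi).tsum_eq]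
  simp only [hω2]
  exact hω1

end

end IsSingleJumpMarket

/-! ### Contraction near the true price -/

/-- The larger one-sided deviation from the price `P`, per unit of weight at `P`. -/
def oddsRisk (b : ℤ → ℝ) (P : ℤ) : ℝ := max (upside b P) (downside b P) / b P

lemma mul_sqrt_div_le {L X κ m b : ℝ} (hL : 0 ≤ L) (hκ : 0 ≤ κ) (hX : X ≤ κ * m) (hb : 0 < b) :
    L * √(X / (L * b)) ≤ √(κ * L) * √(m / b) := by
  rcases hL.eq_or_lt with rfl | hL
  · simp
  calc L * √(X / (L * b)) ≤ √(L ^ 2) * √(κ * m / (L * b)) := by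
        rw [Real.sqrt_sq hL.le]
        gcongr
    _ = √(κ * L * (m / b)) := by
        rw [← Real.sqrt_mul (sq_nonneg _)]
        congr 1
        field_simp
    _ = √(κ * L) * √(m / b) := Real.sqrt_mul (by positivity) _

section OneStep

variable {α : ℝ} (hα0 : 0 < α) (hα1 : α < 1)
include hα0 hα1

/-- Prices are integers, so all those above P are at least P + 1, beyond the ask, and share one
likelihood. -/
lemma evidence_mul_upside {b : ℤ → ℝ} (hb : IsBelief b) (d : Trade) {P : ℤ}
    (hP : askPrice α b < P + 1) :
    evidence α b d * upside (nextBelief α 0 b d) P =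
      ((if Trade.buy = d then α else 0) + if d = .none then 0 else (1 - α) / 2) * upside b P := by
  unfold upside
  rw [← tsum_mul_left, ← tsum_mul_left]
  refine tsum_congr fun q => ?_
  rw [mul_left_comm, evidence_mul_nextBelief hα0 hα1 (Or.inl hb)]
  rcases le_or_gt q P with h | h
  · have : (q : ℝ) - P ≤ 0 := by rw [sub_nonpos]; exact_mod_cast h
    rw [max_eq_right this]; ring
  · have hq : typ α b q = .buy := by
      rw [typ_eq_buy_iff]
      have : (P : ℝ) + 1 ≤ q := by exact_mod_cast h
      linarith
    rw [like, hq]; ring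

lemma evidence_mul_downside {b : ℤ → ℝ} (hb : IsBelief b) (d : Trade) {P : ℤ}
    (hP : P - 1 < bidPrice α b) :
    evidence α b d * downside (nextBelief α 0 b d) P =
      ((if Trade.sell = d then α else 0) + if d = .none then 0 else (1 - α) / 2) *
        downside b P := by
  unfold downside
  rw [← tsum_mul_left, ← tsum_mul_left]
  refine tsum_congr fun q => ?_
  rw [mul_left_comm, evidence_mul_nextBelief hα0 hα1 (Or.inl hb)]
  rcases le_or_gt P q with h | h
  · have : (P : ℝ) - q ≤ 0 := by rw [sub_nonpos]; exact_mod_cast h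
    rw [max_eq_right this]; ring
  · have hq : typ α b q = .sell := by
      rw [typ_eq_sell_iff hα0 hα1 hb]
      have : (q : ℝ) + 1 ≤ P := by exact_mod_cast h
      linarith
    rw [like, hq]; ring

/-- Once both quotes are within one tick of the price, the root of `oddsRisk` contracts in
expectation. -/
lemma sum_like_mul_sqrt_oddsRisk_le {b : ℤ → ℝ} (hb : IsBelief b) {P : ℤ} (hbP : 0 < b P)
    (hask : askPrice α b < P + 1) (hbid : P - 1 < bidPrice α b) :
    ∑ d, like α b d P * √(oddsRisk (nextBelief α 0 b d) P) ≤
      2 * √((1 - α) / 2 * ((1 + α) / 2)) * √(oddsRisk b P) := by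
  have hU := hb.upside_nonneg P
  have hD := hb.downside_nonneg P
  have hterm : ∀ d κ, 0 ≤ κ → max (((if Trade.buy = d then α else 0) + if d = .none then 0 else
        (1 - α) / 2) * upside b P) (((if Trade.sell = d then α else 0) + if d = .none then 0 else
        (1 - α) / 2) * downside b P) ≤ κ * max (upside b P) (downside b P) →
      like α b d P * √(oddsRisk (nextBelief α 0 b d) P) ≤
        √(κ * like α b d P) * √(oddsRisk b P) := by
    intro d κ hκ h
    have hL := like_nonneg hα0 hα1 b d P
    refine le_trans (le_of_eq ?_) (mul_sqrt_div_le hL hκ h hbP)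
    rw [← evidence_mul_upside hα0 hα1 hb d hask, ← evidence_mul_downside hα0 hα1 hb d hbid,
      ← evidence_mul_nextBelief hα0 hα1 (Or.inl hb),
      ← mul_max_of_nonneg _ _ (evidence_nonneg hα0 hα1 (Or.inl hb) d)]
    rcases eq_or_ne (evidence α b d) 0 with h0 | h0
    · have h1 := evidence_mul_nextBelief hα0 hα1 (Or.inl hb) d P
      rw [h0, zero_mul] at h1
      rw [(mul_eq_zero.mp h1.symm).resolve_right hbP.ne']
      simp
    · rw [mul_div_mul_left _ _ h0, oddsRisk]
  have hm : 0 ≤ max (upside b P) (downside b P) := le_max_of_le_left hU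
  have hmU := le_max_left (upside b P) (downside b P)
  have hmD := le_max_right (upside b P) (downside b P)
  have hbuy := hterm .buy
  have hsell := hterm .sell
  -- Within one tick, every other price makes an informed trader trade. A slot without trade thus
  -- removes all the risk.
  have hnone := hterm .none 0 le_rfl (by simp)
  have hR := Real.sqrt_nonneg (oddsRisk b P)
  simp only [reduceCtorEq, if_true, if_false, zero_add, zero_mul, Real.sqrt_zero]
    at hbuy hsell hnone
  have e1 : √((1 - α) / 2 * (α + (1 - α) / 2)) = √((1 - α) / 2 * ((1 + α) / 2)) := by
    congr 1; ring
  have e2 : √((1 + α) / 2 * ((1 - α) / 2)) = √((1 - α) / 2 * ((1 + α) / 2)) := by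
    congr 1; ring
  rw [sum_trade]
  rcases htyp : typ α b P with _ | _ | _
  · have hlt := (hb.askPrice_lt_iff hα0 hα1 P).mp (typ_eq_buy_iff.mp htyp)
    have h1 := hbuy ((1 - α) / 2) (by linarith) (max_le (by nlinarith) (by nlinarith))
    have h2 := hsell ((1 + α) / 2) (by linarith) (max_le (by nlinarith) (by nlinarith))
    simp only [like, htyp, reduceCtorEq, if_true, if_false, zero_add, e1, e2] at h1 h2 hnone ⊢
    linarith
  · have hlt := (hb.lt_bidPrice_iff hα0 hα1 P).mp ((typ_eq_sell_iff hα0 hα1 hb).mp htyp)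
    have h1 := hbuy ((1 + α) / 2) (by linarith) (max_le (by nlinarith) (by nlinarith))
    have h2 := hsell ((1 - α) / 2) (by linarith) (max_le (by nlinarith) (by nlinarith))
    simp only [like, htyp, reduceCtorEq, if_true, if_false, zero_add, e1, e2] at h1 h2 hnone ⊢
    linarith
  · have h1 := hbuy ((1 + α) / 2) (by linarith) (max_le (by nlinarith) (by nlinarith))
    have h2 := hsell ((1 + α) / 2) (by linarith) (max_le (by nlinarith) (by nlinarith))
    simp only [like, htyp, reduceCtorEq, if_true, if_false, zero_add, e2] at h1 h2 hnone ⊢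
    linarith

lemma spread_le_oddsRisk {b : ℤ → ℝ} (hb : IsBelief b) {P : ℤ} (hbP : 0 < b P) :
    |askPrice α b - bidPrice α b| ≤ 4 * ((1 + α) / (1 - α)) * oddsRisk b P := by
  have h1 := hb.abs_askPrice_sub_le hα0 hα1 P
  have h2 := hb.abs_bidPrice_sub_le hα0 hα1 P
  have hκ : 0 ≤ (1 + α) / (1 - α) := div_nonneg (by linarith) (by linarith)
  have h3 : |askPrice α b - bidPrice α b| ≤
      |askPrice α b - P| + |bidPrice α b - P| := by
    rw [abs_sub_comm (bidPrice α b)]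
    exact abs_sub_le _ _ _
  have hm : max (upside b P) (downside b P) ≤ oddsRisk b P := by
    rw [oddsRisk, le_div_iff₀ hbP]
    have := hb.le_one P
    have h0 : 0 ≤ max (upside b P) (downside b P) := le_max_of_le_left (hb.upside_nonneg P)
    nlinarith
  have h4 : upside b P + downside b P ≤ 2 * oddsRisk b P := by
    linarith [le_max_left (upside b P) (downside b P), le_max_right (upside b P) (downside b P)]
  nlinarith

end OneStep

lemma exists_le_exp_of_le_pow {x : ℕ → ℝ} {r C : ℝ} (hr0 : 0 < r) (hr1 : r < 1) (T : ℕ)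
    (h : ∀ n, |x (T + n)| ≤ C * r ^ n) :
    ∃ C', ∀ t : ℕ, |x t| ≤ C' * Real.exp (-(-Real.log r) * t) := by
  have hexp : ∀ t : ℕ, Real.exp (-(-Real.log r) * t) = r ^ t := fun t => by
    rw [neg_neg, mul_comm, Real.exp_nat_mul, Real.exp_log hr0]
  have hC : 0 ≤ C := by
    have := (abs_nonneg _).trans (h 0)
    simpa using this
  set S := ∑ s ∈ Finset.range T, |x s| with hS
  have hS0 : 0 ≤ S := Finset.sum_nonneg fun _ _ => abs_nonneg _
  refine ⟨(C + S) / r ^ T, fun t => ?_⟩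
  rw [hexp, div_mul_eq_mul_div, le_div_iff₀ (by positivity)]
  rcases le_or_gt T t with ht | ht
  · obtain ⟨n, rfl⟩ := Nat.exists_eq_add_of_le ht
    have := h n
    rw [pow_add]
    have hrT : 0 < r ^ T := by positivity
    have hrn : 0 < r ^ n := by positivity
    nlinarith [mul_nonneg hS0 (mul_pos hrT hrn).le]
  · have h1 : |x t| ≤ S :=
      Finset.single_le_sum (f := fun s => |x s|) (fun _ _ => abs_nonneg _)
        (Finset.mem_range.mpr ht)
    have h2 : r ^ T ≤ r ^ t := pow_le_pow_of_le_one hr0.le hr1.le ht.le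
    have h3 : 0 < r ^ T := by positivity
    calc |x t| * r ^ T ≤ S * r ^ t := by gcongr
      _ ≤ (C + S) * r ^ t := by gcongr; linarith

/-! ### Almost sure convergence of the quotes and rate of the spread -/

/-- The belief is proper, gives weight to `P`, and its quotes are within one tick of `P`. -/
def Close (α : ℝ) (b : ℤ → ℝ) (P : ℤ) : Prop :=
  IsBelief b ∧ 0 < b P ∧ askPrice α b < P + 1 ∧ P - 1 < bidPrice α b

/-- All beliefs along the history from time `T` on, except possibly the last one, are close
to `P`. -/
def CloseFrom (α : ℝ) (D : PMF ℤ) (T : ℕ) (P : ℤ) : List Trade → Prop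
  | [] => True
  | _ :: h => CloseFrom α D T P h ∧ (T ≤ h.length → Close α (beliefAt α D h) P)

namespace IsSingleJumpMarket

variable [MeasurableSpace Ω] {μ : Measure Ω} {α : ℝ} {D : PMF ℤ}
  {pext : Ω → ℤ} {trader : ℕ → Ω → Trader}

variable [IsProbabilityMeasure μ] (hα0 : 0 < α) (hα1 : α < 1)
  (hD : Summable fun p : ℤ => |(p : ℝ)| * (D p).toReal)
  (hM : IsSingleJumpMarket μ α D pext trader)
include hα0 hα1 hD hM

/-- The beliefs concentrate on the price, in mean. -/
lemma ae_tendsto_deviation :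
    ∀ᵐ ω ∂μ, Tendsto (fun t =>
      upside (beliefAt α D (tradesUpTo α D pext trader t ω)) (pext ω) +
      downside (beliefAt α D (tradesUpTo α D pext trader t ω)) (pext ω)) atTop (𝓝 0) := by
  have h1 := ae_all_iff.mpr fun t => hM.ae_isBelief hα0 hα1 hD t
  have h2 := ae_all_iff.mpr fun p => ae_all_iff.mpr fun q =>
    hM.ae_tendsto_sepOverlap hα0 hα1 hD p q
  have h3 := ae_all_iff.mpr fun k : ℤ => hM.ae_tendsto_tsum_belief hα0 hα1 hD
    (f := fun p => max ((p : ℝ) - k) 0) (fun p => le_max_right _ _)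
    (fun p => IsBelief.abs_pos_part_le p k)
  have h4 := ae_all_iff.mpr fun k : ℤ => hM.ae_tendsto_tsum_belief hα0 hα1 hD
    (f := fun p => max ((k : ℝ) - p) 0) (fun p => le_max_right _ _)
    (fun p => IsBelief.abs_neg_part_le p k)
  have h5 := ae_all_iff.mpr fun k : ℤ => hM.ae_tendsto_tsum_belief hα0 hα1 hD
    (f := fun p => if p = k then 1 else 0) (A := 1) (B := 0)
    (fun p => by split_ifs <;> norm_num) (fun p => by split_ifs <;> norm_num)
  filter_upwards [h1, h2, h3, h4, h5, hM.ae_limitLaw_pext_ne_zero,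
    hM.ae_integrable_limitLaw hα0 hα1 hD] with ω w1 w2 w3 w4 w5 w6 w7
  have hb := isBelief_of_measure w7
  simp only [ite_mul, one_mul, zero_mul, tsum_ite_eq] at w5
  -- The limit law has a single atom, which must be the true price because that price is charged.
  have hone : ∀ q, (hM.limitLaw ω).real {q} ≠ 0 → q = pext ω := fun q hq =>
    hb.eq_of_tendsto hα0 hα1 w1 w5 w3 w4 w2 hq w6
  have hU0 := (hb.upside_eq_zero_iff (pext ω)).mpr fun q hq => by
    by_contra hne
    rw [hone q hne] at hq
    exact lt_irrefl _ hq
  have hD0 := (hb.downside_eq_zero_iff (pext ω)).mpr fun q hq => by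
    by_contra hne
    rw [hone q hne] at hq
    exact lt_irrefl _ hq
  have h := (w3 (pext ω)).add (w4 (pext ω))
  change Tendsto _ _ (𝓝 (upside (fun p => (hM.limitLaw ω).real {p}) (pext ω) +
    downside (fun p => (hM.limitLaw ω).real {p}) (pext ω))) at h
  rw [hU0, hD0, add_zero] at h
  exact h

lemma ae_tendsto_ask :
    ∀ᵐ ω ∂μ, Tendsto (fun t => ask α D pext trader t ω) atTop (𝓝 (pext ω)) := by
  filter_upwards [hM.ae_tendsto_deviation hα0 hα1 hD,
    ae_all_iff.mpr fun t => hM.ae_isBelief hα0 hα1 hD t] with ω h hb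
  rw [tendsto_iff_norm_sub_tendsto_zero]
  refine squeeze_zero (fun t => norm_nonneg _) (fun t => ?_)
    (by simpa using h.const_mul ((1 + α) / (1 - α)))
  rw [ask_eq]
  exact (hb t).abs_askPrice_sub_le hα0 hα1 _

lemma ae_tendsto_bid :
    ∀ᵐ ω ∂μ, Tendsto (fun t => bid α D pext trader t ω) atTop (𝓝 (pext ω)) := by
  filter_upwards [hM.ae_tendsto_deviation hα0 hα1 hD,
    ae_all_iff.mpr fun t => hM.ae_isBelief hα0 hα1 hD t] with ω h hb
  rw [tendsto_iff_norm_sub_tendsto_zero]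
  refine squeeze_zero (fun t => norm_nonneg _) (fun t => ?_)
    (by simpa using h.const_mul ((1 + α) / (1 - α)))
  rw [bid_eq]
  exact (hb t).abs_bidPrice_sub_le hα0 hα1 _

lemma ae_exists_forall_close :
    ∀ᵐ ω ∂μ, ∃ T, ∀ t ≥ T,
      Close α (beliefAt α D (tradesUpTo α D pext trader t ω)) (pext ω) := by
  filter_upwards [hM.ae_tendsto_ask hα0 hα1 hD, hM.ae_tendsto_bid hα0 hα1 hD,
    ae_all_iff.mpr fun t => hM.ae_isBelief hα0 hα1 hD t,
    ae_all_iff.mpr fun t => hM.ae_beliefAt_pext_ne_zero hα0 hα1 hD t] with ω h1 h2 h3 h4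
  have e1 := h1.eventually_lt_const (show (pext ω : ℝ) < pext ω + 1 by linarith)
  have e2 := h2.eventually_const_lt (show (pext ω : ℝ) - 1 < pext ω by linarith)
  obtain ⟨T, hT⟩ := eventually_atTop.mp (e1.and e2)
  refine ⟨T, fun t ht => ⟨h3 t, lt_of_le_of_ne ((h3 t).nonneg _) (h4 t).symm, ?_, ?_⟩⟩
  · have := (hT t ht).1; rwa [ask_eq] at this
  · have := (hT t ht).2; rwa [bid_eq] at this

omit hD in
open Classical in
/-- The root of the risk at the price `P`, as long as the beliefs stay close to `P` from `T` on. -/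
lemma ae_exists_sqrt_oddsRisk_le (P : ℤ) (T : ℕ) :
    ∀ᵐ ω ∂μ, ∃ C : ℝ, ∀ n, pext ω = P →
      CloseFrom α D T P (tradesUpTo α D pext trader (T + n) ω) →
      √(oddsRisk (beliefAt α D (tradesUpTo α D pext trader (T + n) ω)) P) ≤
        C * √(2 * √((1 - α) / 2 * ((1 + α) / 2))) ^ n := by
  set r := 2 * √((1 - α) / 2 * ((1 + α) / 2)) with hr
  have hr0 : 0 < r := by
    have : 0 < (1 - α) / 2 * ((1 + α) / 2) := mul_pos (by linarith) (by linarith)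
    positivity
  have hr1 : r < 1 := by linarith [sqrt_mul_lt_half hα0]
  -- Expectations decay like r^n = s^n·s^n. Half of this pays for the weight s^(-n) and the other
  -- half makes the series converge; squaring the resulting bound s^n restores the rate r for the
  -- risk itself.
  set s := √r with hs
  have hs0 : 0 < s := Real.sqrt_pos.mpr hr0
  have hs1 : s < 1 := by rw [hs, Real.sqrt_lt' one_pos]; linarith
  set F : ℤ → List Trade → ℝ≥0∞ := fun p h => if p = P ∧ CloseFrom α D T P h then
    ENNReal.ofReal √(oddsRisk (beliefAt α D h) P) else 0 with hF
  set X : ℕ → ℝ≥0∞ := fun n =>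
    ∫⁻ ω, F (pext ω) (tradesUpTo α D pext trader (T + n) ω) ∂μ with hX
  have hstep : ∀ n, X (n + 1) ≤ ENNReal.ofReal r * X n := by
    intro n
    have h := hM.lintegral_succ hα0 hα1 (T + n) F
    simp only [hX]
    rw [← add_assoc, h, ← lintegral_const_mul' _ _ ENNReal.ofReal_ne_top]
    refine lintegral_mono fun ω => ?_
    have hlen : (tradesUpTo α D pext trader (T + n) ω).length = T + n := length_history _ _ _ _ _
    set h := tradesUpTo α D pext trader (T + n) ω
    -- The condition on d :: h does not involve d, so the indicator is predictable and comes out of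
    -- the sum over the next trade.
    by_cases hc : pext ω = P ∧ (CloseFrom α D T P h ∧ (T ≤ h.length → Close α (beliefAt α D h) P))
    · obtain ⟨hb, hbP, h1, h2⟩ := hc.2.2 (by omega)
      have hF1 : ∀ d, F (pext ω) (d :: h) =
          ENNReal.ofReal √(oddsRisk (beliefAt α D (d :: h)) P) := fun d => if_pos hc
      have hF2 : F (pext ω) h = ENNReal.ofReal √(oddsRisk (beliefAt α D h) P) :=
        if_pos ⟨hc.1, hc.2.1⟩
      simp only [hF1, hF2, ← ENNReal.ofReal_mul (like_nonneg hα0 hα1 _ _ _),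
        ← ENNReal.ofReal_mul hr0.le]
      rw [← ENNReal.ofReal_sum_of_nonneg fun d _ =>
        mul_nonneg (like_nonneg hα0 hα1 _ _ _) (Real.sqrt_nonneg _), hc.1]
      exact ENNReal.ofReal_le_ofReal (sum_like_mul_sqrt_oddsRisk_le hα0 hα1 hb hbP h1 h2)
    · have hF1 : ∀ d, F (pext ω) (d :: h) = 0 := fun d => if_neg hc
      simp [hF1]
  have hpow : ∀ n, X n ≤ ENNReal.ofReal (r ^ n) * X 0 := by
    intro n
    induction n with
    | zero => simp
    | succ n ih =>
      refine (hstep n).trans ((mul_le_mul_right ih _).trans_eq ?_)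
      rw [← mul_assoc, ← ENNReal.ofReal_mul hr0.le, pow_succ']
  have hX0 : X 0 ≠ ∞ := by
    -- At a fixed time there are only finitely many histories, so the initial risk is bounded.
    have hfin : ((fun h => √(oddsRisk (beliefAt α D h) P)) '' {h | h.length = T}).Finite :=
      (List.finite_length_eq Trade T).image _
    obtain ⟨C, hC⟩ := hfin.bddAbove
    refine ne_top_of_le_ne_top (b := ENNReal.ofReal C) ENNReal.ofReal_ne_top ?_
    calc X 0 ≤ ∫⁻ _, ENNReal.ofReal C ∂μ := lintegral_mono fun ω => by
          simp only [hF]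
          split_ifs
          · exact ENNReal.ofReal_le_ofReal (hC ⟨_, length_history _ _ _ _ _, rfl⟩)
          · exact zero_le
      _ = ENNReal.ofReal C := by simp
  have hFm : ∀ n, Measurable fun ω => ENNReal.ofReal ((s ^ n)⁻¹) *
      F (pext ω) (tradesUpTo α D pext trader (T + n) ω) := fun n =>
    (measurable_of_countable fun z : ℤ × List Trade =>
      ENNReal.ofReal ((s ^ n)⁻¹) * F z.1 z.2).comp
        (hM.measurable_pext.prodMk (hM.measurable_tradesUpTo (T + n)))
  have hsum : ∫⁻ ω, ∑' n, ENNReal.ofReal ((s ^ n)⁻¹) *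
      F (pext ω) (tradesUpTo α D pext trader (T + n) ω) ∂μ ≠ ∞ := by
    rw [lintegral_tsum fun n => (hFm n).aemeasurable]
    have hle : ∀ n, ∫⁻ ω, ENNReal.ofReal ((s ^ n)⁻¹) *
        F (pext ω) (tradesUpTo α D pext trader (T + n) ω) ∂μ ≤ ENNReal.ofReal (s ^ n) * X 0 := by
      intro n
      rw [lintegral_const_mul' _ _ ENNReal.ofReal_ne_top]
      refine (mul_le_mul_right (hpow n) _).trans_eq ?_
      rw [← mul_assoc, ← ENNReal.ofReal_mul (by positivity)]
      congr 2
      have : r ^ n = s ^ n * s ^ n := by rw [← mul_pow, Real.mul_self_sqrt hr0.le]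
      rw [this]
      field_simp
    refine ne_top_of_le_ne_top ?_ (ENNReal.tsum_le_tsum hle)
    rw [ENNReal.tsum_mul_right]
    refine ENNReal.mul_ne_top ?_ hX0
    rw [← ENNReal.ofReal_tsum_of_nonneg (fun n => by positivity)
      (summable_geometric_of_lt_one hs0.le hs1)]
    exact ENNReal.ofReal_ne_top
  filter_upwards [ae_lt_top' (AEMeasurable.tsum fun n => (hFm n).aemeasurable) hsum] with ω hω
  refine ⟨(∑' n, ENNReal.ofReal ((s ^ n)⁻¹) *
      F (pext ω) (tradesUpTo α D pext trader (T + n) ω)).toReal, fun n hP hc => ?_⟩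
  have h1 := ENNReal.le_tsum (f := fun n => ENNReal.ofReal ((s ^ n)⁻¹) *
      F (pext ω) (tradesUpTo α D pext trader (T + n) ω)) n
  have h2 := ENNReal.toReal_mono hω.ne h1
  have hFe : F (pext ω) (tradesUpTo α D pext trader (T + n) ω) = ENNReal.ofReal
      √(oddsRisk (beliefAt α D (tradesUpTo α D pext trader (T + n) ω)) P) := by
    simp only [hF, if_pos (And.intro hP hc)]
  rw [hFe, ENNReal.toReal_mul, ENNReal.toReal_ofReal (by positivity),
    ENNReal.toReal_ofReal (Real.sqrt_nonneg _)] at h2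
  rwa [inv_mul_le_iff₀ (by positivity), mul_comm] at h2

omit hα0 hα1 hD hM [IsProbabilityMeasure μ] [MeasurableSpace Ω] in
lemma closeFrom_of_forall {T : ℕ} {ω : Ω} {P : ℤ}
    (h : ∀ t ≥ T, Close α (beliefAt α D (tradesUpTo α D pext trader t ω)) P) (t : ℕ) :
    CloseFrom α D T P (tradesUpTo α D pext trader t ω) := by
  induction t with
  | zero => trivial
  | succ t ih =>
    refine ⟨ih, fun hT => h t ?_⟩
    rwa [length_history] at hT

/-- The spread decays exponentially, almost surely. -/
lemma ae_exists_spread_le :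
    ∀ᵐ ω ∂μ, ∃ C : ℝ, ∀ t : ℕ,
      |ask α D pext trader t ω - bid α D pext trader t ω| ≤
        C * Real.exp (-(-Real.log (2 * √((1 - α) / 2 * ((1 + α) / 2)))) * t) := by
  set r := 2 * √((1 - α) / 2 * ((1 + α) / 2)) with hr
  have hr0 : 0 < r := by
    have : 0 < (1 - α) / 2 * ((1 + α) / 2) := mul_pos (by linarith) (by linarith)
    positivity
  have hr1 : r < 1 := by linarith [sqrt_mul_lt_half hα0]
  -- The time after which the quotes stay close depends on the future. The estimate is therefore
  -- taken for all deterministic P and T at once, and specialized pathwise.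
  filter_upwards [ae_all_iff.mpr fun P => ae_all_iff.mpr fun T =>
    hM.ae_exists_sqrt_oddsRisk_le hα0 hα1 P T, hM.ae_exists_forall_close hα0 hα1 hD]
    with ω h1 ⟨T, hT⟩
  obtain ⟨C, hC⟩ := h1 (pext ω) T
  refine exists_le_exp_of_le_pow (C := 4 * ((1 + α) / (1 - α)) * C ^ 2) hr0 hr1 T fun n => ?_
  obtain ⟨hb, hbP, -, -⟩ := hT (T + n) (by omega)
  have h2 := hC n rfl (closeFrom_of_forall hT _)
  have h3 := spread_le_oddsRisk hα0 hα1 hb hbP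
  rw [ask_eq, bid_eq]
  refine h3.trans ?_
  have h4 : oddsRisk (beliefAt α D (tradesUpTo α D pext trader (T + n) ω)) (pext ω) ≤
      C ^ 2 * r ^ n := by
    have := (Real.sqrt_le_left ((Real.sqrt_nonneg _).trans h2)).mp h2
    rwa [mul_pow, ← pow_mul, mul_comm n 2, pow_mul, Real.sq_sqrt hr0.le] at this
  rw [mul_assoc _ (C ^ 2)]
  exact mul_le_mul_of_nonneg_left h4
    (mul_nonneg (by norm_num) (div_nonneg (by linarith) (by linarith)))

end IsSingleJumpMarket

/-! ### Finite support: uniform contraction of the total overlap -/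

/-- The total overlap of distinct prices in `S`. -/
def totalOverlap (S : Finset ℤ) (b : ℤ → ℝ) : ℝ :=
  ∑ p ∈ S, ∑ q ∈ S, if p = q then 0 else √(b p * b q)

lemma totalOverlap_nonneg (S : Finset ℤ) (b : ℤ → ℝ) : 0 ≤ totalOverlap S b :=
  Finset.sum_nonneg fun p _ => Finset.sum_nonneg fun q _ => by split_ifs <;> positivity

section FiniteSupport

variable {b : ℤ → ℝ} {S : Finset ℤ}

lemma upside_eq_sum (hS : ∀ p ∉ S, b p = 0) (x : ℝ) :
    upside b x = ∑ p ∈ S, max ((p : ℝ) - x) 0 * b p :=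
  tsum_eq_sum fun p hp => by simp [hS p hp]

lemma downside_eq_sum (hS : ∀ p ∉ S, b p = 0) (x : ℝ) :
    downside b x = ∑ p ∈ S, max (x - (p : ℝ)) 0 * b p :=
  tsum_eq_sum fun p hp => by simp [hS p hp]

lemma IsBelief.sum_eq_one (hb : IsBelief b) (hS : ∀ p ∉ S, b p = 0) : ∑ p ∈ S, b p = 1 := by
  rw [← hb.hasSum.tsum_eq, tsum_eq_sum fun p hp => hS p hp]

lemma IsBelief.exists_mode (hb : IsBelief b) (hS : ∀ p ∉ S, b p = 0) :
    ∃ P ∈ S, (∀ q, b q ≤ b P) ∧ 1 ≤ (S.card : ℝ) * b P := by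
  have h1 := hb.sum_eq_one hS
  have hne : S.Nonempty := by
    rw [Finset.nonempty_iff_ne_empty]
    rintro rfl
    simp at h1
  obtain ⟨P, hP, hmax⟩ := S.exists_max_image b hne
  refine ⟨P, hP, fun q => ?_, ?_⟩
  · by_cases hq : q ∈ S
    · exact hmax q hq
    · rw [hS q hq]; exact hb.nonneg P
  · rw [← h1, ← nsmul_eq_mul]
    exact Finset.sum_le_card_nsmul S b (b P) hmax

/-- The weight of the prices in `S` which the quotes tell apart from `P`. -/
def sepMass (α : ℝ) (S : Finset ℤ) (b : ℤ → ℝ) (P : ℤ) : ℝ :=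
  ∑ q ∈ S, if typ α b q = typ α b P then 0 else b q

variable {α R : ℝ} {P : ℤ}

lemma IsBelief.upside_le_sepMass (hb : IsBelief b) (hS : ∀ p ∉ S, b p = 0) (hP : P ∈ S)
    (hR : ∀ p ∈ S, ∀ q ∈ S, |(p : ℝ) - q| ≤ R) {x : ℝ} (hx : (P : ℝ) ≤ x)
    (hsep : ∀ q ∈ S, x < q → typ α b q ≠ typ α b P) : upside b x ≤ R * sepMass α S b P := by
  rw [upside_eq_sum hS, sepMass, Finset.mul_sum]
  have hR0 : 0 ≤ R := (abs_nonneg _).trans (hR P hP P hP)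
  refine Finset.sum_le_sum fun q hq => ?_
  have hbq := hb.nonneg q
  rcases lt_or_ge x (q : ℝ) with h | h
  · rw [if_neg (hsep q hq h), max_eq_left (by linarith)]
    refine mul_le_mul_of_nonneg_right ?_ hbq
    linarith [le_abs_self ((q : ℝ) - P), hR q hq P hP]
  · rw [max_eq_right (by linarith), zero_mul]
    split_ifs <;> positivity

lemma IsBelief.downside_le_sepMass (hb : IsBelief b) (hS : ∀ p ∉ S, b p = 0) (hP : P ∈ S)
    (hR : ∀ p ∈ S, ∀ q ∈ S, |(p : ℝ) - q| ≤ R) {x : ℝ} (hx : x ≤ P)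
    (hsep : ∀ q ∈ S, q < x → typ α b q ≠ typ α b P) : downside b x ≤ R * sepMass α S b P := by
  rw [downside_eq_sum hS, sepMass, Finset.mul_sum]
  have hR0 : 0 ≤ R := (abs_nonneg _).trans (hR P hP P hP)
  refine Finset.sum_le_sum fun q hq => ?_
  have hbq := hb.nonneg q
  rcases lt_or_ge (q : ℝ) x with h | h
  · rw [if_neg (hsep q hq h), max_eq_left (by linarith)]
    refine mul_le_mul_of_nonneg_right ?_ hbq
    linarith [le_abs_self ((P : ℝ) - q), hR P hP q hq]
  · rw [max_eq_right (by linarith), zero_mul]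
    split_ifs <;> positivity

/-- Prices beyond x are separated from P. Any other price above P contributes at most (x - P)·b(P),
since P is the mode, and this is P's own term in D(x). -/
lemma IsBelief.upside_mode_le (hb : IsBelief b) (hS : ∀ p ∉ S, b p = 0) (hP : P ∈ S)
    (hR : ∀ p ∈ S, ∀ q ∈ S, |(p : ℝ) - q| ≤ R) (hmode : ∀ q, b q ≤ b P) {x : ℝ}
    (hx : (P : ℝ) ≤ x) (hsep : ∀ q ∈ S, x < q → typ α b q ≠ typ α b P) :
    upside b P ≤ R * sepMass α S b P + S.card * downside b x := by
  have hR0 : 0 ≤ R := (abs_nonneg _).trans (hR P hP P hP)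
  have hD : (x - P) * b P ≤ downside b x := by
    have := (hb.summable_downside x).le_tsum P fun q _ =>
      mul_nonneg (le_max_right _ _) (hb.nonneg q)
    rwa [max_eq_left (by linarith)] at this
  have hD0 := hb.downside_nonneg x
  rw [upside_eq_sum hS, sepMass, Finset.mul_sum, ← nsmul_eq_mul, ← Finset.sum_const,
    ← Finset.sum_add_distrib]
  refine Finset.sum_le_sum fun q hq => ?_
  have hbq := hb.nonneg q
  rcases lt_or_ge x (q : ℝ) with h | h
  · rw [if_neg (hsep q hq h), max_eq_left (by linarith)]
    have := mul_le_mul_of_nonneg_right ((le_abs_self _).trans (hR q hq P hP)) hbq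
    linarith
  · have h1 : max ((q : ℝ) - P) 0 * b q ≤ (x - P) * b P :=
      mul_le_mul (max_le (by linarith) (by linarith)) (hmode q) hbq (by linarith)
    have h2 : 0 ≤ R * if typ α b q = typ α b P then 0 else b q := by
      split_ifs <;> positivity
    linarith

lemma IsBelief.downside_mode_le (hb : IsBelief b) (hS : ∀ p ∉ S, b p = 0) (hP : P ∈ S)
    (hR : ∀ p ∈ S, ∀ q ∈ S, |(p : ℝ) - q| ≤ R) (hmode : ∀ q, b q ≤ b P) {x : ℝ}
    (hx : x ≤ P) (hsep : ∀ q ∈ S, q < x → typ α b q ≠ typ α b P) :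
    downside b P ≤ R * sepMass α S b P + S.card * upside b x := by
  have hR0 : 0 ≤ R := (abs_nonneg _).trans (hR P hP P hP)
  have hU : (P - x) * b P ≤ upside b x := by
    have := (hb.summable_upside x).le_tsum P fun q _ =>
      mul_nonneg (le_max_right _ _) (hb.nonneg q)
    rwa [max_eq_left (by linarith)] at this
  have hU0 := hb.upside_nonneg x
  rw [downside_eq_sum hS, sepMass, Finset.mul_sum, ← nsmul_eq_mul, ← Finset.sum_const,
    ← Finset.sum_add_distrib]
  refine Finset.sum_le_sum fun q hq => ?_
  have hbq := hb.nonneg q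
  rcases lt_or_ge (q : ℝ) x with h | h
  · rw [if_neg (hsep q hq h), max_eq_left (by linarith)]
    have := mul_le_mul_of_nonneg_right ((le_abs_self _).trans (hR P hP q hq)) hbq
    linarith
  · have h1 : max ((P : ℝ) - q) 0 * b q ≤ (P - x) * b P :=
      mul_le_mul (max_le (by linarith) (by linarith)) (hmode q) hbq (by linarith)
    have h2 : 0 ≤ R * if typ α b q = typ α b P then 0 else b q := by
      split_ifs <;> positivity
    linarith

variable (hα0 : 0 < α) (hα1 : α < 1)
include hα0 hα1

/-- The quotes tell the mode apart from prices which carry a positive share of the deviation from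
the mode. -/
lemma IsBelief.deviation_le_sepMass (hb : IsBelief b) (hS : ∀ p ∉ S, b p = 0) (hP : P ∈ S)
    (hR : ∀ p ∈ S, ∀ q ∈ S, |(p : ℝ) - q| ≤ R) (hmode : ∀ q, b q ≤ b P) :
    upside b P + downside b P ≤ (1 + (1 + α) / (1 - α)) *
      ((1 + S.card * ((1 + α) / (1 - α))) * R) * sepMass α S b P := by
  have hβ : 0 < 1 - α := by linarith
  set κ := (1 + α) / (1 - α) with hκ
  have hκe : κ * (1 - α) = 1 + α := div_mul_cancel₀ _ hβ.ne'
  have hκ1 : 1 ≤ κ := by rw [hκ, le_div_iff₀ hβ]; linarith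
  have hU := hb.upside_nonneg P
  have hD := hb.downside_nonneg P
  have hcmp : ∀ {y z : ℝ}, (1 - α) / 2 * y ≤ (1 + α) / 2 * z → y ≤ κ * z := fun {y z} h => by
    rw [← hκe] at h
    nlinarith
  have hcmp' : ∀ {y z : ℝ}, 0 ≤ z → (1 + α) / 2 * y ≤ (1 - α) / 2 * z → y ≤ κ * z :=
    fun {y z} hz h => by
      have : y ≤ z := by nlinarith
      nlinarith
  have hn : (0 : ℝ) ≤ S.card := Nat.cast_nonneg _
  -- In each case a quote x serves as threshold: what lies beyond it, away from P, is separated from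
  -- P. Balance at x bounds the other deviation at x, and comparing x with P bounds the remaining
  -- deviation at P.
  rcases htyp : typ α b P with _ | _ | _
  · have ha := typ_eq_buy_iff.mp htyp
    have hlt := (hb.askPrice_lt_iff hα0 hα1 P).mp ha
    have hsep : ∀ q ∈ S, (q : ℝ) < askPrice α b → typ α b q ≠ typ α b P := fun q _ hq => by
      rw [htyp, Ne, typ_eq_buy_iff]; exact not_lt.mpr hq.le
    have h1 := hb.downside_le_sepMass hS hP hR ha.le hsep
    have h2 := hb.downside_mode_le hS hP hR hmode ha.le hsep
    have h3 := hcmp' (hb.downside_nonneg _) (hb.askPrice_balance hα0 hα1).le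
    have h4 := hcmp' hD hlt.le
    have h5 : downside b P ≤ (1 + S.card * κ) * R * sepMass α S b P := by
      have : (S.card : ℝ) * upside b (askPrice α b) ≤
          S.card * (κ * (R * sepMass α S b P)) := by
        gcongr
        exact h3.trans (by gcongr)
      linarith
    nlinarith
  all_goals
    obtain ⟨x, hx, hsep, h3, h4⟩ : ∃ x : ℝ, (P : ℝ) ≤ x ∧
        (∀ q ∈ S, x < q → typ α b q ≠ typ α b P) ∧ downside b x ≤ κ * upside b x ∧
        downside b P ≤ κ * upside b P := by
      first
      | have ha := (typ_eq_sell_iff hα0 hα1 hb).mp htyp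
        refine ⟨bidPrice α b, ha.le, fun q _ hq => ?_,
          hcmp' (hb.upside_nonneg _) (hb.bidPrice_balance hα0 hα1).le,
          hcmp' hU ((hb.lt_bidPrice_iff hα0 hα1 P).mp ha).le⟩
        rw [htyp, Ne, typ_eq_sell_iff hα0 hα1 hb]
        exact not_lt.mpr hq.le
      | have ha : ¬ askPrice α b < P := fun h => by
          rw [← typ_eq_buy_iff, htyp] at h; cases h
        refine ⟨askPrice α b, not_lt.mp ha, fun q _ hq => ?_,
          hcmp (hb.askPrice_balance hα0 hα1).ge,
          hcmp (not_lt.mp fun h => ha ((hb.askPrice_lt_iff hα0 hα1 P).mpr h))⟩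
        rw [htyp, typ_eq_buy_iff.mpr hq]
        simp
    have h1 := hb.upside_le_sepMass hS hP hR hx hsep
    have h2 := hb.upside_mode_le hS hP hR hmode hx hsep
    have h5 : upside b P ≤ (1 + S.card * κ) * R * sepMass α S b P := by
      have : (S.card : ℝ) * downside b x ≤ S.card * (κ * (R * sepMass α S b P)) := by
        gcongr
        exact h3.trans (by gcongr)
      linarith
    nlinarith

omit hα0 hα1 in
lemma IsBelief.one_sub_le_deviation (hb : IsBelief b) (hS : ∀ p ∉ S, b p = 0) (hP : P ∈ S) :
    1 - b P ≤ upside b P + downside b P := by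
  rw [upside_eq_sum hS, downside_eq_sum hS, ← hb.sum_eq_one hS, ← Finset.sum_add_distrib,
    ← Finset.add_sum_erase S b hP, add_sub_cancel_left]
  refine (Finset.sum_le_sum fun q hq => ?_).trans (Finset.sum_le_sum_of_subset_of_nonneg
    (Finset.erase_subset P S) fun q _ _ => add_nonneg
      (mul_nonneg (le_max_right _ _) (hb.nonneg q)) (mul_nonneg (le_max_right _ _) (hb.nonneg q)))
  have hbq := hb.nonneg q
  rw [← add_mul]
  have h1 : 1 ≤ max ((q : ℝ) - P) 0 + max ((P : ℝ) - q) 0 := by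
    rcases lt_or_gt_of_ne (Finset.ne_of_mem_erase hq) with h | h
    · have : (q : ℝ) + 1 ≤ P := by exact_mod_cast h
      linarith [le_max_right ((q : ℝ) - P) 0, le_max_left ((P : ℝ) - q) 0]
    · have : (P : ℝ) + 1 ≤ q := by exact_mod_cast h
      linarith [le_max_left ((q : ℝ) - P) 0, le_max_right ((P : ℝ) - q) 0]
  nlinarith

omit hα0 hα1 in
lemma IsBelief.totalOverlap_le (hb : IsBelief b) (hP : P ∈ S) (hS : ∀ p ∉ S, b p = 0) :
    totalOverlap S b ≤ S.card * S.card * √(1 - b P) := by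
  have hle : ∀ q ∈ S, q ≠ P → b q ≤ 1 - b P := fun q hq hqP => by
    have h1 := Finset.add_sum_erase S b hP
    have h2 := Finset.single_le_sum (f := b) (fun r _ => hb.nonneg r)
      (Finset.mem_erase.mpr ⟨hqP, hq⟩)
    rw [hb.sum_eq_one hS] at h1
    linarith
  unfold totalOverlap
  calc _ ≤ ∑ p ∈ S, ∑ q ∈ S, √(1 - b P) := by
        refine Finset.sum_le_sum fun p hp => Finset.sum_le_sum fun q hq => ?_
        split_ifs with h
        · positivity
        · refine Real.sqrt_le_sqrt ?_
          have := hb.nonneg p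
          have := hb.nonneg q
          have := hb.le_one p
          have := hb.le_one q
          by_cases hpP : p = P
          · have := hle q hq fun h' => h (hpP.trans h'.symm)
            nlinarith
          · have := hle p hp hpP
            nlinarith
    _ = _ := by simp [mul_assoc]

omit hα0 hα1 in
lemma IsBelief.deviation_le_totalOverlap (hb : IsBelief b) (hS : ∀ p ∉ S, b p = 0) (hP : P ∈ S)
    (hR : ∀ p ∈ S, ∀ q ∈ S, |(p : ℝ) - q| ≤ R) (hmode : ∀ q, b q ≤ b P) :
    upside b P + downside b P ≤ R * totalOverlap S b := by
  have hR0 : 0 ≤ R := (abs_nonneg _).trans (hR P hP P hP)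
  calc upside b P + downside b P ≤ R * ∑ q ∈ S, if P = q then 0 else √(b P * b q) := by
        rw [upside_eq_sum hS, downside_eq_sum hS, ← Finset.sum_add_distrib, Finset.mul_sum]
        refine Finset.sum_le_sum fun q hq => ?_
        split_ifs with h
        · simp [h]
        · have hbq := hb.nonneg q
          have h1 : b q ≤ √(b P * b q) := by
            refine Real.le_sqrt_of_sq_le ?_
            nlinarith [hmode q]
          have h2 : max ((q : ℝ) - P) 0 + max ((P : ℝ) - q) 0 ≤ R := by
            refine le_trans (le_of_eq ?_) (hR q hq P hP)
            rcases le_total (q : ℝ) P with h | h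
            · rw [max_eq_right (by linarith), max_eq_left (by linarith),
                abs_of_nonpos (by linarith)]; ring
            · rw [max_eq_left (by linarith), max_eq_right (by linarith),
                abs_of_nonneg (by linarith)]; ring
          rw [← add_mul]
          exact mul_le_mul h2 h1 hbq hR0
    _ ≤ R * totalOverlap S b := by
        refine mul_le_mul_of_nonneg_left ?_ hR0
        exact Finset.single_le_sum
          (f := fun p => ∑ q ∈ S, if p = q then 0 else √(b p * b q))
          (fun p _ => Finset.sum_nonneg fun q _ => by split_ifs <;> positivity) hP

omit hα0 hα1 in
-- Pigeonhole: one separated price carries at least the share 1/|S| of the mass, and the mode has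
-- weight at least 1/|S|, so this one pair already gives the bound.
lemma IsBelief.sqrt_sepMass_le (hb : IsBelief b) (hP : P ∈ S)
    (hcard : 1 ≤ (S.card : ℝ) * b P) :
    √(sepMass α S b P) ≤ S.card * ∑ p ∈ S, ∑ q ∈ S, sepOverlap α b p q := by
  have hn : (0 : ℝ) < S.card := by
    rcases (Nat.cast_nonneg (α := ℝ) S.card).eq_or_lt with h | h
    · rw [← h] at hcard; linarith
    · exact h
  obtain ⟨q, hq, hle⟩ : ∃ q ∈ S, sepMass α S b P / S.card ≤
      if typ α b q = typ α b P then 0 else b q := by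
    refine Finset.exists_le_of_sum_le ⟨P, hP⟩ (le_of_eq ?_)
    rw [Finset.sum_const, nsmul_eq_mul, mul_div_cancel₀ _ hn.ne']
    rfl
  rw [div_le_iff₀ hn] at hle
  have h1 : sepOverlap α b P q ≤ ∑ p ∈ S, ∑ q ∈ S, sepOverlap α b p q :=
    (Finset.single_le_sum (f := fun q => sepOverlap α b P q)
      (fun r _ => sepOverlap_nonneg α b P r) hq).trans
    (Finset.single_le_sum (f := fun p => ∑ q ∈ S, sepOverlap α b p q)
      (fun p _ => Finset.sum_nonneg fun r _ => sepOverlap_nonneg α b p r) hP)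
  refine le_trans ?_ (mul_le_mul_of_nonneg_left h1 hn.le)
  split_ifs at hle with h
  · rw [Real.sqrt_eq_zero_of_nonpos (by linarith)]
    exact mul_nonneg hn.le (sepOverlap_nonneg α b P q)
  · rw [sepOverlap, if_neg fun h' => h h'.symm]
    rw [Real.sqrt_le_left (by positivity), mul_pow,
      Real.sq_sqrt (mul_nonneg (hb.nonneg P) (hb.nonneg q))]
    have hbq := hb.nonneg q
    calc sepMass α S b P ≤ b q * S.card * 1 := by linarith
      _ ≤ b q * S.card * (S.card * b P) := by gcongr
      _ = _ := by ring

/-- On beliefs carried by `S` the total overlap contracts in expectation, at a uniform rate. -/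
lemma exists_totalOverlap_contraction (S : Finset ℤ) :
    ∃ r : ℝ, 0 < r ∧ r < 1 ∧ ∀ b : ℤ → ℝ, IsBelief b → (∀ p ∉ S, b p = 0) →
      ∑ d, evidence α b d * totalOverlap S (nextBelief α 0 b d) ≤ r * totalOverlap S b := by
  set R : ℝ := ∑ p ∈ S, ∑ q ∈ S, |(p : ℝ) - q| with hRdef
  have hR : ∀ p ∈ S, ∀ q ∈ S, |(p : ℝ) - q| ≤ R := fun p hp q hq =>
    (Finset.single_le_sum (f := fun q : ℤ => |(p : ℝ) - q|) (fun _ _ => abs_nonneg _) hq).trans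
      (Finset.single_le_sum (f := fun p : ℤ => ∑ q ∈ S, |(p : ℝ) - q|)
        (fun _ _ => Finset.sum_nonneg fun _ _ => abs_nonneg _) hp)
  set C₀ := (1 + (1 + α) / (1 - α)) * ((1 + S.card * ((1 + α) / (1 - α))) * R) with hC₀
  have hC₀0 : 0 ≤ C₀ := by
    have : 0 ≤ (1 + α) / (1 - α) := div_nonneg (by linarith) (by linarith)
    have : 0 ≤ R := Finset.sum_nonneg fun _ _ => Finset.sum_nonneg fun _ _ => abs_nonneg _
    positivity
  -- The product of the constants bounding the total overlap by the separated overlap; the added 1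
  -- keeps it at least 1, so that the rate lies strictly between 0 and 1.
  set C₁ := (S.card : ℝ) * S.card * √C₀ * S.card + 1 with hC₁
  have hC₁1 : 1 ≤ C₁ := by
    have : 0 ≤ (S.card : ℝ) * S.card * √C₀ * S.card := by positivity
    linarith
  have hρ := affinity_lt_one hα0
  have hρ0 : 0 < affinity α := by unfold affinity; positivity
  have hδ : (1 - affinity α) / C₁ < 1 := by
    rw [div_lt_one (by linarith)]; linarith
  have hδ0 : 0 < (1 - affinity α) / C₁ := div_pos (by linarith) (by linarith)
  refine ⟨1 - (1 - affinity α) / C₁, by linarith, by linarith, fun b hb hS => ?_⟩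
  obtain ⟨P, hP, hmode, hcard⟩ := hb.exists_mode hS
  set E := ∑ p ∈ S, ∑ q ∈ S, sepOverlap α b p q with hE
  have hE0 : 0 ≤ E :=
    Finset.sum_nonneg fun p _ => Finset.sum_nonneg fun q _ => sepOverlap_nonneg α b p q
  have h1 : totalOverlap S b ≤ C₁ * E := by
    have h2 : √(1 - b P) ≤ √C₀ * (S.card * E) := by
      refine (Real.sqrt_le_sqrt ((hb.one_sub_le_deviation hS hP).trans
        (hb.deviation_le_sepMass hα0 hα1 hS hP hR hmode))).trans ?_
      rw [Real.sqrt_mul hC₀0]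
      exact mul_le_mul_of_nonneg_left (hb.sqrt_sepMass_le hP hcard) (Real.sqrt_nonneg _)
    calc totalOverlap S b ≤ S.card * S.card * √(1 - b P) := hb.totalOverlap_le hP hS
      _ ≤ S.card * S.card * (√C₀ * (S.card * E)) := by gcongr
      _ ≤ C₁ * E := by rw [hC₁]; linarith
  have h2 : ∑ d, evidence α b d * totalOverlap S (nextBelief α 0 b d) + (1 - affinity α) * E ≤
      totalOverlap S b := by
    simp only [totalOverlap, hE, Finset.mul_sum]
    rw [Finset.sum_comm, ← Finset.sum_add_distrib]
    refine Finset.sum_le_sum fun p _ => ?_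
    rw [Finset.sum_comm, ← Finset.sum_add_distrib]
    refine Finset.sum_le_sum fun q _ => ?_
    split_ifs with h
    · simp [h, sepOverlap]
    · exact sum_evidence_mul_sqrt_le hα0 hα1 (Or.inl hb) p q
  have h3 : (1 - affinity α) / C₁ * totalOverlap S b ≤ (1 - affinity α) * E := by
    rw [div_mul_eq_mul_div, div_le_iff₀ (by linarith)]
    have := mul_le_mul_of_nonneg_left h1 (show 0 ≤ 1 - affinity α by linarith)
    linarith
  linarith

lemma exists_spread_le_totalOverlap (S : Finset ℤ) :
    ∃ C : ℝ, 0 ≤ C ∧ ∀ b : ℤ → ℝ, IsBelief b → (∀ p ∉ S, b p = 0) →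
      |askPrice α b - bidPrice α b| ≤ C * totalOverlap S b := by
  set R : ℝ := ∑ p ∈ S, ∑ q ∈ S, |(p : ℝ) - q| with hRdef
  have hR : ∀ p ∈ S, ∀ q ∈ S, |(p : ℝ) - q| ≤ R := fun p hp q hq =>
    (Finset.single_le_sum (f := fun q : ℤ => |(p : ℝ) - q|) (fun _ _ => abs_nonneg _) hq).trans
      (Finset.single_le_sum (f := fun p : ℤ => ∑ q ∈ S, |(p : ℝ) - q|)
        (fun _ _ => Finset.sum_nonneg fun _ _ => abs_nonneg _) hp)
  have hR0 : 0 ≤ R := Finset.sum_nonneg fun _ _ => Finset.sum_nonneg fun _ _ => abs_nonneg _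
  have hκ : 0 ≤ (1 + α) / (1 - α) := div_nonneg (by linarith) (by linarith)
  refine ⟨2 * ((1 + α) / (1 - α)) * R, by positivity, fun b hb hS => ?_⟩
  obtain ⟨P, hP, hmode, -⟩ := hb.exists_mode hS
  have h1 := hb.abs_askPrice_sub_le hα0 hα1 P
  have h2 := hb.abs_bidPrice_sub_le hα0 hα1 P
  have h3 := hb.deviation_le_totalOverlap hS hP hR hmode
  have h4 : |askPrice α b - bidPrice α b| ≤ |askPrice α b - P| + |bidPrice α b - P| := by
    rw [abs_sub_comm (bidPrice α b)]
    exact abs_sub_le _ _ _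
  have h5 := mul_le_mul_of_nonneg_left h3 hκ
  linarith

lemma beliefAt_eq_zero {D : PMF ℤ} (hD : Summable fun p : ℤ => |(p : ℝ)| * (D p).toReal)
    {p : ℤ} (hp : D p = 0) (h : List Trade) : beliefAt α D h p = 0 := by
  induction h with
  | nil => simp [beliefAt, hp]
  | cons d h ih =>
    rw [beliefAt, nextBelief_eq hα0 hα1 (isBelief_or_zero_beliefAt hα0 hα1 hD h), ih]
    simp

end FiniteSupport

/-! ### Measurability of the quotes and the expected spread -/

namespace IsSingleJumpMarket

variable [MeasurableSpace Ω] {μ : Measure Ω} {α : ℝ} {D : PMF ℤ}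
  {pext : Ω → ℤ} {trader : ℕ → Ω → Trader}

lemma measurable_ask (hM : IsSingleJumpMarket μ α D pext trader) (t : ℕ) :
    Measurable (ask α D pext trader t) := by
  rw [show ask α D pext trader t = _ from funext (ask_eq α D pext trader t)]
  exact hM.measurable_comp_tradesUpTo t fun h => askPrice α (beliefAt α D h)

lemma measurable_bid (hM : IsSingleJumpMarket μ α D pext trader) (t : ℕ) :
    Measurable (bid α D pext trader t) := by
  rw [show bid α D pext trader t = _ from funext (bid_eq α D pext trader t)]
  exact hM.measurable_comp_tradesUpTo t fun h => bidPrice α (beliefAt α D h)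

variable [IsProbabilityMeasure μ]

lemma integrable_spread (hM : IsSingleJumpMarket μ α D pext trader) (t : ℕ) :
    Integrable (fun ω => |ask α D pext trader t ω - bid α D pext trader t ω|) μ := by
  have hfin : ((fun h => |askPrice α (beliefAt α D h) - bidPrice α (beliefAt α D h)|) ''
      {h | h.length = t}).Finite := (List.finite_length_eq Trade t).image _
  obtain ⟨C, hC⟩ := hfin.bddAbove
  refine Integrable.of_bound
    ((hM.measurable_ask t).sub (hM.measurable_bid t)).abs.aestronglyMeasurable C
    (ae_of_all _ fun ω => ?_)
  rw [Real.norm_eq_abs, abs_abs, ask_eq, bid_eq]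
  exact hC ⟨_, length_history _ _ _ _ _, rfl⟩

variable (hα0 : 0 < α) (hα1 : α < 1)
  (hD : Summable fun p : ℤ => |(p : ℝ)| * (D p).toReal)
  (hM : IsSingleJumpMarket μ α D pext trader)
include hα0 hα1 hD hM

/-- For a finitely supported prior the expected spread decays exponentially. -/
lemma exists_integral_spread_le (hfin : D.support.Finite) :
    ∃ c : ℝ, 0 < c ∧ ∃ C : ℝ, ∀ t : ℕ,
      ∫ ω, |ask α D pext trader t ω - bid α D pext trader t ω| ∂μ ≤ C * Real.exp (-c * t) := by
  set S := hfin.toFinset with hSdef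
  have hS : ∀ h, ∀ p ∉ S, beliefAt α D h p = 0 := fun h p hp =>
    beliefAt_eq_zero hα0 hα1 hD (by simpa [hSdef] using hp) h
  obtain ⟨r, hr0, hr1, hr⟩ := exists_totalOverlap_contraction hα0 hα1 S
  obtain ⟨C, hC0, hC⟩ := exists_spread_le_totalOverlap hα0 hα1 S
  set Φ : List Trade → ℝ := fun h => totalOverlap S (beliefAt α D h) with hΦ
  have hΦ0 : ∀ h, 0 ≤ Φ h := fun h => totalOverlap_nonneg S _
  have hstep : ∀ t, ∫⁻ ω, ENNReal.ofReal (Φ (tradesUpTo α D pext trader (t + 1) ω)) ∂μ ≤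
      ENNReal.ofReal r * ∫⁻ ω, ENNReal.ofReal (Φ (tradesUpTo α D pext trader t ω)) ∂μ := by
    intro t
    rw [hM.lintegral_succ_evidence hα0 hα1 hD t fun h => ENNReal.ofReal (Φ h),
      ← lintegral_const_mul' _ _ ENNReal.ofReal_ne_top]
    refine lintegral_mono_ae ?_
    filter_upwards [hM.ae_isBelief hα0 hα1 hD t] with ω hb
    have hev := evidence_nonneg hα0 hα1 (Or.inl hb)
    simp only [← ENNReal.ofReal_mul (hev _), ← ENNReal.ofReal_mul hr0.le]
    rw [← ENNReal.ofReal_sum_of_nonneg fun d _ => mul_nonneg (hev d) (hΦ0 _)]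
    exact ENNReal.ofReal_le_ofReal (hr _ hb (hS _))
  have hpow : ∀ t, ∫⁻ ω, ENNReal.ofReal (Φ (tradesUpTo α D pext trader t ω)) ∂μ ≤
      ENNReal.ofReal (r ^ t * Φ []) := by
    intro t
    induction t with
    | zero =>
      have h1 : ∀ ω, tradesUpTo α D pext trader 0 ω = [] := fun _ => rfl
      simp [h1]
    | succ t ih =>
      refine (hstep t).trans ((mul_le_mul_right ih _).trans_eq ?_)
      rw [← ENNReal.ofReal_mul hr0.le, pow_succ', mul_assoc]
  refine ⟨-Real.log r, by linarith [Real.log_neg hr0 hr1], C * Φ [], fun t => ?_⟩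
  have hexp : Real.exp (-(-Real.log r) * t) = r ^ t := by
    rw [neg_neg, mul_comm, Real.exp_nat_mul, Real.exp_log hr0]
  rw [hexp, integral_eq_lintegral_of_nonneg_ae (ae_of_all _ fun ω => abs_nonneg _)
    (hM.integrable_spread t).aestronglyMeasurable]
  refine ENNReal.toReal_le_of_le_ofReal (mul_nonneg (mul_nonneg hC0 (hΦ0 _)) (by positivity)) ?_
  calc ∫⁻ ω, ENNReal.ofReal |ask α D pext trader t ω - bid α D pext trader t ω| ∂μ
      ≤ ∫⁻ ω, ENNReal.ofReal C * ENNReal.ofReal (Φ (tradesUpTo α D pext trader t ω)) ∂μ := by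
        refine lintegral_mono_ae ?_
        filter_upwards [hM.ae_isBelief hα0 hα1 hD t] with ω hb
        rw [← ENNReal.ofReal_mul hC0, ask_eq, bid_eq]
        exact ENNReal.ofReal_le_ofReal (hC _ hb (hS _))
    _ ≤ ENNReal.ofReal C * ENNReal.ofReal (r ^ t * Φ []) := by
        rw [lintegral_const_mul' _ _ ENNReal.ofReal_ne_top]
        exact mul_le_mul_right (hpow t) _
    _ = ENNReal.ofReal (C * Φ [] * r ^ t) := by
        rw [← ENNReal.ofReal_mul hC0]
        congr 1
        ring

end IsSingleJumpMarket

end GlostenMilgrom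

end

theorem theorem1 (α : ℝ) (hα0 : 0 < α) (hα1 : α < 1) :
    ∃ c : ℝ, 0 < c ∧
      ∀ (D : PMF ℤ), (Summable fun p : ℤ => |(p : ℝ)| * (D p).toReal) →
      ∀ (Ω : Type u) [MeasurableSpace Ω] (μ : Measure Ω) [IsProbabilityMeasure μ]
        (pext : Ω → ℤ) (trader : ℕ → Ω → Trader),
        IsSingleJumpMarket μ α D pext trader →
        -- the spread tends to zero exponentially fast, almost surely
        (∀ᵐ ω ∂μ,
          Tendsto (fun t => ask α D pext trader t ω - bid α D pext trader t ω) atTop (𝓝 0) ∧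
          ∃ C : ℝ, ∀ t : ℕ,
            |ask α D pext trader t ω - bid α D pext trader t ω| ≤ C * Real.exp (-c * t)) ∧
        -- for finitely supported jumps, it does so in expectation too
        (D.support.Finite →
          ∃ c' : ℝ, 0 < c' ∧ ∃ C : ℝ, ∀ t : ℕ,
            Integrable (fun ω => |ask α D pext trader t ω - bid α D pext trader t ω|) μ ∧
            ∫ ω, |ask α D pext trader t ω - bid α D pext trader t ω| ∂μ
              ≤ C * Real.exp (-c' * t)) ∧
        -- ask and bid converge in probability to the external price
        (∀ ε : ℝ, 0 < ε →
          Tendsto (fun t => μ {ω | ε ≤ |ask α D pext trader t ω - pext ω|}) atTop (𝓝 0)) ∧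
        (∀ ε : ℝ, 0 < ε →
          Tendsto (fun t => μ {ω | ε ≤ |bid α D pext trader t ω - pext ω|}) atTop (𝓝 0)) := by
  -- This is √(1-α²), the one-step contraction factor near the true price; it is less than 1 because
  -- α > 0.
  set r := 2 * √((1 - α) / 2 * ((1 + α) / 2)) with hr
  have hr0 : 0 < r := by
    have : 0 < (1 - α) / 2 * ((1 + α) / 2) := mul_pos (by linarith) (by linarith)
    positivity
  have hr1 : r < 1 := by linarith [sqrt_mul_lt_half hα0]
  refine ⟨-Real.log r, by linarith [Real.log_neg hr0 hr1], ?_⟩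
  intro D hD Ω _ μ _ pext trader hM
  have hpext : AEStronglyMeasurable (fun ω => (pext ω : ℝ)) μ :=
    ((measurable_of_countable fun p : ℤ => (p : ℝ)).comp hM.measurable_pext).aestronglyMeasurable
  refine ⟨?_, fun hfin => ?_, fun ε hε => ?_, fun ε hε => ?_⟩
  · filter_upwards [hM.ae_exists_spread_le hα0 hα1 hD, hM.ae_tendsto_ask hα0 hα1 hD,
      hM.ae_tendsto_bid hα0 hα1 hD] with ω h1 h2 h3
    exact ⟨by simpa using h2.sub h3, h1⟩
  · obtain ⟨c, hc, C, hC⟩ := hM.exists_integral_spread_le hα0 hα1 hD hfin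
    exact ⟨c, hc, C, fun t => ⟨hM.integrable_spread t, hC t⟩⟩
  · have h := tendstoInMeasure_of_tendsto_ae (fun t => (hM.measurable_ask t).aestronglyMeasurable)
      (hM.ae_tendsto_ask hα0 hα1 hD)
    rw [tendstoInMeasure_iff_norm] at h
    exact h ε hε
  · have h := tendstoInMeasure_of_tendsto_ae (fun t => (hM.measurable_bid t).aestronglyMeasurable)
      (hM.ae_tendsto_bid hα0 hα1 hD)
    rw [tendstoInMeasure_iff_norm] at h
    exact h ε hε
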